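/- \textbf{Setting.} Let $(\Omega,\mathfrak A,P)$ be a probability space, $X:\Omega\to\mathcal X$ a random element of a measurable space (the covariates), and $Z:\Omega\to\mathcal Z$ a random element of a countable partially ordered set (the instrument; e.g. a countable subset of $\mathbb R^{d_z}$ with the componentwise order). Let $\mathcal Y_1,\mathcal Y_0$ assign to each $\omega\in\Omega$ a subset of $\mathbb R$, such that $\omega\mapsto K(\omega)=\mathcal Y_1(\omega)\times\mathcal Y_0(\omega)\subseteq\mathbb R^2$ is a random closed set (each $K(\omega)$ is closed and $\{K\cap C\neq\emptyset\}\in\mathfrak A$ for every compact $C$), is integrable (it has an integrable selection, i.e. an integrable random vector $\xi$ with $\xi\in K$ a.s.), and is almost surely convex. Let $s(v,K)=\sup_{y\in K}\langle v,y\rangle\in[-\infty,\infty]$ be the support function, $v_1=(1,0)'$, $v_0=(0,1)'$. Conditional expectations given $X,Z=z$ are considered where $P(Z=z\mid X)>0$, and expectations of extended-real variables are taken as the expectation of the positive part minus that of the negative part, with values in $[-\infty,\infty]$. A pair $(Y_1,Y_0)$ of integrable random variables with $(Y_1,Y_0)\in\mathcal Y_1\times\mathcal Y_0$ a.s. satisfies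 the \emph{monotone instrumental variable (MIV)} assumption if, for $d\in\{0,1\}$ and all $z\ge z'$ in $\mathcal Z$, $$E[Y_d\mid X,Z=z]\ \ge\ E[Y_d\mid X,Z=z']$$ almost surely where $P(Z=z\mid X)>0$ and $P(Z=z'\mid X)>0$. Assume that the true potential outcomes are such a pair, i.e. that at least one such pair exists. For measurable treatment rules $\delta,\delta^*:\mathcal X\to\{0,1\}$ let $$B_I(\delta,\delta^*)=\Big\{E\big[E[Y_1-Y_0\mid X]\,(\delta(X)-\delta^*(X))\big]:\ (Y_1,Y_0)\text{ an integrable selection of }\mathcal Y_1\times\mathcal Y_0\text{ satisfying the MIV assumption}\Big\}\subseteq\mathbb R$$ be the sharp identified region of the welfare gain, and let $\theta_{10}=\mathbf 1\{\delta=1,\delta^*=0\}$, $\theta_{01}=\mathbf 1\{\delta=0,\delta^*=1\}$. \textbf{Theorem (MIV).} $B_I(\delta,\delta^*)$ is the interval $\{\beta\in\mathbb R:\beta_l\le\beta\le\beta_u\}$, where $$\beta_l=E\big[\underline\Delta(X)\,\theta_{10}(X)-\bar\Delta(X)\,\theta_{01}(X)\big],\qquad \beta_u=E\big[\bar\Delta(X)\,\theta_{10}(X)-\underline\Delta(X)\,\theta_{01}(X)\big]$$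 (elements of $[-\infty,\infty]$), with $$\underline\Delta(X)=\sum_{z\in\mathcal Z}P(Z=z\mid X)\Big(\sup_{z_1\le z}\big\{-E[s(-v_1,\mathcal Y_1\times\mathcal Y_0)\mid X,Z=z_1]\big\}-\inf_{z_2\ge z}\big\{E[s(v_0,\mathcal Y_1\times\mathcal Y_0)\mid X,Z=z_2]\big\}\Big),$$ $$\bar\Delta(X)=\sum_{z\in\mathcal Z}P(Z=z\mid X)\Big(\inf_{z_2\ge z}\big\{E[s(v_1,\mathcal Y_1\times\mathcal Y_0)\mid X,Z=z_2]\big\}-\sup_{z_1\le z}\big\{-E[s(-v_0,\mathcal Y_1\times\mathcal Y_0)\mid X,Z=z_1]\big\}\Big),$$ where the suprema and infima run over the $z_1$, $z_2$ with $P(Z=z_1\mid X)>0$, $P(Z=z_2\mid X)>0$. Moreover, if $Z$ is independent of $X$, then the same holds with the weights $P(Z=z\mid X)$ replaced by $P(Z=z)$. -/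

import Mathlib

open MeasureTheory ProbabilityTheory
open scoped ENNReal

namespace WelfareGain

noncomputable section

/-! ### Extended-real expectations -/

/-- Expectation of an extended-real random variable: the integral of the positive part minus the
integral of the negative part, each of them in `[0, ∞]`. -/
def eExp {Ω : Type*} [MeasurableSpace Ω] (μ : Measure Ω) (f : Ω → EReal) : EReal :=
  ((∫⁻ ω, (f ω).toENNReal ∂μ : ℝ≥0∞) : EReal) - ((∫⁻ ω, (-f ω).toENNReal ∂μ : ℝ≥0∞) : EReal)

/-- Conditional expectation, given the sub-σ-algebra `m`, of an extended-real random variable: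
the conditional expectation of the positive part minus that of the negative part. -/
def eCondExp {Ω : Type*} [mΩ : MeasurableSpace Ω] (μ : Measure[mΩ] Ω) (m : MeasurableSpace Ω)
    (f : Ω → EReal) (ω : Ω) : EReal :=
  ((condLExp m μ (fun ω' => (f ω').toENNReal) ω : ℝ≥0∞) : EReal) -
    ((condLExp m μ (fun ω' => (-f ω').toENNReal) ω : ℝ≥0∞) : EReal)

/-- Sum of a family of extended reals: the sum of the positive parts minus the sum of the
negative parts. -/
def eSum {ι : Type*} (a : ι → EReal) : EReal :=
  ((∑' i, (a i).toENNReal : ℝ≥0∞) : EReal) - ((∑' i, (-a i).toENNReal : ℝ≥0∞) : EReal)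

/-! ### Random sets -/

/-- Random closed sets: `K ω` is closed, and `{ω | K ω ∩ C ≠ ∅}` is an event for every
compact `C`. -/
def IsRandomClosedSet {Ω E : Type*} [MeasurableSpace Ω] [TopologicalSpace E]
    (K : Ω → Set E) : Prop :=
  (∀ ω, IsClosed (K ω)) ∧ ∀ C : Set E, IsCompact C → MeasurableSet {ω | (K ω ∩ C).Nonempty}

/-- Integrable selections of a random set in the plane. -/
def IsIntegrableSelection {Ω : Type*} [MeasurableSpace Ω] (μ : Measure Ω)
    (K : Ω → Set (ℝ × ℝ)) (ξ : Ω → ℝ × ℝ) : Prop :=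
  Measurable ξ ∧ Integrable ξ μ ∧ ∀ᵐ ω ∂μ, ξ ω ∈ K ω

/-- A random closed set is integrable if it has an integrable selection. -/
def IsIntegrableRandomSet {Ω : Type*} [MeasurableSpace Ω] (μ : Measure Ω)
    (K : Ω → Set (ℝ × ℝ)) : Prop :=
  IsRandomClosedSet K ∧ ∃ ξ : Ω → ℝ × ℝ, IsIntegrableSelection μ K ξ

/-- Support function `s(v, K) = sup_{y ∈ K} ⟨v, y⟩` of a subset of the plane. -/
def supportFun (v : ℝ × ℝ) (K : Set (ℝ × ℝ)) : EReal :=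
  ⨆ y ∈ K, ((v.1 * y.1 + v.2 * y.2 : ℝ) : EReal)

/-! ### Conditioning on the covariates and on a value of the instrument -/

/-- The σ-algebra generated by `X`. -/
abbrev sigma {Ω 𝒳 : Type*} [MeasurableSpace 𝒳] (X : Ω → 𝒳) : MeasurableSpace Ω :=
  MeasurableSpace.comap X inferInstance

section Model

variable {Ω 𝒳 𝒵 : Type*} [MeasurableSpace Ω] [MeasurableSpace 𝒳]

/-- `P(Z = z | X)`. -/
def probGiven (μ : Measure Ω) (X : Ω → 𝒳) (Z : Ω → 𝒵) (z : 𝒵) : Ω → ℝ :=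
  μ[(Z ⁻¹' {z}).indicator (fun _ => (1 : ℝ)) | sigma X]

/-- `E[Y | X, Z = z]`, as a function of `X`: the conditional expectation given `X` under the
conditional probability `P( · | Z = z)`. It is determined almost surely on the event
`P(Z = z | X) > 0`. -/
def meanGiven (μ : Measure Ω) (X : Ω → 𝒳) (Z : Ω → 𝒵) (Y : Ω → ℝ) (z : 𝒵) : Ω → ℝ :=
  condExp (sigma X) (ProbabilityTheory.cond μ (Z ⁻¹' {z})) Y

/-- The conditional expected support function `E[s(v, K) | X, Z = z]`. -/
def suppGiven (μ : Measure Ω) (X : Ω → 𝒳) (Z : Ω → 𝒵) (K : Ω → Set (ℝ × ℝ)) (v : ℝ × ℝ)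
    (z : 𝒵) : Ω → EReal :=
  eCondExp (ProbabilityTheory.cond μ (Z ⁻¹' {z})) (sigma X) (fun ω => supportFun v (K ω))

/-- Mean monotonicity: `E[Y | X, Z = z] ≥ E[Y | X, Z = z']` almost surely whenever `z ≥ z'`,
where both conditional expectations make sense. -/
def MeanMonotone [LE 𝒵] (μ : Measure Ω) (X : Ω → 𝒳) (Z : Ω → 𝒵) (Y : Ω → ℝ) : Prop :=
  ∀ z z' : 𝒵, z' ≤ z → ∀ᵐ ω ∂μ, 0 < probGiven μ X Z z ω → 0 < probGiven μ X Z z' ω →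
    meanGiven μ X Z Y z' ω ≤ meanGiven μ X Z Y z ω

/-- `sup_{z₁ ≤ z} { -E[s(-v, K) | X, Z = z₁] }`, over the `z₁` with `P(Z = z₁ | X) > 0`. -/
def supLower [LE 𝒵] (μ : Measure Ω) (X : Ω → 𝒳) (Z : Ω → 𝒵) (K : Ω → Set (ℝ × ℝ))
    (v : ℝ × ℝ) (z : 𝒵) (ω : Ω) : EReal :=
  ⨆ z₁ ∈ {z₁ : 𝒵 | z₁ ≤ z ∧ 0 < probGiven μ X Z z₁ ω}, -suppGiven μ X Z K (-v) z₁ ω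

/-- `inf_{z₂ ≥ z} E[s(v, K) | X, Z = z₂]`, over the `z₂` with `P(Z = z₂ | X) > 0`. -/
def infUpper [LE 𝒵] (μ : Measure Ω) (X : Ω → 𝒳) (Z : Ω → 𝒵) (K : Ω → Set (ℝ × ℝ))
    (v : ℝ × ℝ) (z : 𝒵) (ω : Ω) : EReal :=
  ⨅ z₂ ∈ {z₂ : 𝒵 | z ≤ z₂ ∧ 0 < probGiven μ X Z z₂ ω}, suppGiven μ X Z K v z₂ ω

/-- Lower bound on the conditional average treatment effect, with weights `w z` on the values of
the instrument; `(1, 0)` is `v₁` and `(0, 1)` is `v₀`. -/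
def cateLower [LE 𝒵] (μ : Measure Ω) (X : Ω → 𝒳) (Z : Ω → 𝒵) (K : Ω → Set (ℝ × ℝ))
    (w : 𝒵 → Ω → ℝ) (ω : Ω) : EReal :=
  eSum fun z => (w z ω : EReal) *
    (supLower μ X Z K (1, 0) z ω - infUpper μ X Z K (0, 1) z ω)

/-- Upper bound on the conditional average treatment effect, with weights `w z` on the values of
the instrument. -/
def cateUpper [LE 𝒵] (μ : Measure Ω) (X : Ω → 𝒳) (Z : Ω → 𝒵) (K : Ω → Set (ℝ × ℝ))
    (w : 𝒵 → Ω → ℝ) (ω : Ω) : EReal :=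
  eSum fun z => (w z ω : EReal) *
    (infUpper μ X Z K (1, 0) z ω - supLower μ X Z K (0, 1) z ω)

/-! ### Welfare gain -/

/-- The indicator `1{δ(x) = 1, δ'(x) = 0}`. -/
def switch (δ δ' : 𝒳 → Fin 2) (x : 𝒳) : EReal := if δ x = 1 ∧ δ' x = 0 then 1 else 0

/-- `E[lo · θ₁₀(X) - up · θ₀₁(X)]`, where `θ₁₀ = 1{δ = 1, δ' = 0}` and
`θ₀₁ = 1{δ = 0, δ' = 1}`. -/
def gainBound (μ : Measure Ω) (X : Ω → 𝒳) (δ δ' : 𝒳 → Fin 2) (lo up : Ω → EReal) : EReal :=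
  eExp μ fun ω => lo ω * switch δ δ' (X ω) - up ω * switch δ' δ (X ω)

/-- The welfare gain `E[E[Y₁ - Y₀ | X] (δ(X) - δ'(X))]` from switching from `δ'` to `δ`. -/
def welfareGain (μ : Measure Ω) (X : Ω → 𝒳) (δ δ' : 𝒳 → Fin 2) (Y₁ Y₀ : Ω → ℝ) : ℝ :=
  ∫ ω, (μ[fun ω' => Y₁ ω' - Y₀ ω' | sigma X]) ω *
    (((δ (X ω) : ℕ) : ℝ) - ((δ' (X ω) : ℕ) : ℝ)) ∂μ

/-- `(Y₁, Y₀)` is consistent with the random set `K` and with the instrument being a monotone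
instrumental variable. -/
def IsMIVSelection [LE 𝒵] (μ : Measure Ω) (X : Ω → 𝒳) (Z : Ω → 𝒵) (K : Ω → Set (ℝ × ℝ))
    (Y₁ Y₀ : Ω → ℝ) : Prop :=
  IsIntegrableSelection μ K (fun ω => (Y₁ ω, Y₀ ω)) ∧
    MeanMonotone μ X Z Y₁ ∧ MeanMonotone μ X Z Y₀

/-- The sharp identified region of the welfare gain under the monotone instrumental variable
assumption. -/
def identifiedSet [LE 𝒵] (μ : Measure Ω) (X : Ω → 𝒳) (Z : Ω → 𝒵) (K : Ω → Set (ℝ × ℝ))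
    (δ δ' : 𝒳 → Fin 2) : Set ℝ :=
  {β | ∃ Y₁ Y₀ : Ω → ℝ, IsMIVSelection μ X Z K Y₁ Y₀ ∧ β = welfareGain μ X δ δ' Y₁ Y₀}

/-- The interval of reals between the lower bound `E[lo · θ₁₀ - up · θ₀₁]` and the upper bound
`E[up · θ₁₀ - lo · θ₀₁]`, where `lo` and `up` are the bounds on the conditional average treatment
effect with weights `w`. -/
def mivInterval [LE 𝒵] (μ : Measure Ω) (X : Ω → 𝒳) (Z : Ω → 𝒵) (K : Ω → Set (ℝ × ℝ))
    (w : 𝒵 → Ω → ℝ) (δ δ' : 𝒳 → Fin 2) : Set ℝ :=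
  {β | gainBound μ X δ δ' (cateLower μ X Z K w) (cateUpper μ X Z K w) ≤ (β : EReal) ∧
    (β : EReal) ≤ gainBound μ X δ δ' (cateUpper μ X Z K w) (cateLower μ X Z K w)}

end Model

end

end WelfareGain

namespace WelfareGain

open Filter

/-! ### Arithmetic of extended reals -/

/-! Fix one MIV selection `(Y₁, Y₀)`. The mean of `Y₁` given `X, Z = z` is at most its mean at any
higher `z₂`, hence at most the expected support function there, hence at most the envelope obtained
by taking the infimum over `z₂`. The lower bounds are the same statement for `-Y` and the reversed
order, so everything is done for a general relation `r` and for upper envelopes only. Weighting by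
`P(Z = z | X)` and integrating over the events where the rules differ shows that the upper bound
equals the welfare gain plus a nonnegative slack, possibly infinite
(`gainBound_eq_welfareGain_add`). Each extended-real quantity is kept as an integrable or summable
real part plus a `[0, ∞]` part, up to sign, so `∞ - ∞` never arises.

For sharpness, an outcome `Y` below `S` is raised on each fibre `{Z = z}` by a variable between `0`
and `S - Y` whose conditional mean is exactly the gap to the envelope (`exists_le_condLExp_eq`,
`exists_raise`). The new means equal the envelope, which is itself monotone in `z`, so MIV survives.
If the slack is infinite, the increase is capped at a constant `N`: the means become the minimum of
the envelope and the old mean plus `N`, still monotone, and the gain tends to infinity with `N`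
(`exists_gainSlack_ge`). Closedness and convexity keep the raised outcomes in the random set, and
its product form allows the two coordinates to be moved independently.

Thus any real number not above the upper bound is dominated by an attained gain. Exchanging the two
rules negates gains and bounds and settles the lower end. MIV selections form a convex set on which
the gain is affine, so everything in between is attained. -/

lemma toENNReal_add_coe (c : ℝ) (d : ℝ≥0∞) :
    ((c : EReal) + d).toENNReal + ENNReal.ofReal (-c) =
      (-((c : EReal) + d)).toENNReal + (ENNReal.ofReal c + d) := by
  induction d using ENNReal.recTopCoe with
  | top => simp
  | coe d =>
    have h : ((c : EReal) + ((d : ℝ≥0∞) : EReal)) = ((c + d : ℝ) : EReal) := by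
      rw [EReal.coe_add]; rfl
    rw [h, ← EReal.coe_neg, EReal.real_coe_toENNReal, EReal.real_coe_toENNReal,
      ← ENNReal.ofReal_coe_nnreal]
    have hd : (0 : ℝ) ≤ d := d.2
    rcases le_total 0 c with hc | hc
    · rw [ENNReal.ofReal_of_nonpos (by linarith : -c ≤ 0),
        ENNReal.ofReal_of_nonpos (by linarith : -(c + (d : ℝ)) ≤ 0), ENNReal.ofReal_add hc hd,
        add_zero, zero_add]
    · rw [ENNReal.ofReal_of_nonpos hc, zero_add]
      rcases le_total 0 (c + (d : ℝ)) with hs | hs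
      · rw [ENNReal.ofReal_of_nonpos (by linarith : -(c + (d : ℝ)) ≤ 0), zero_add,
          ← ENNReal.ofReal_add hs (by linarith), add_neg_cancel_comm]
      · rw [ENNReal.ofReal_of_nonpos hs, zero_add, ← ENNReal.ofReal_add (by linarith) hd]
        congr 1; ring

lemma toReal_ofReal_sub_toReal_ofReal_neg (c : ℝ) :
    (ENNReal.ofReal c).toReal - (ENNReal.ofReal (-c)).toReal = c := by
  rw [ENNReal.toReal_ofReal', ENNReal.toReal_ofReal', max_zero_sub_max_neg_zero_eq_self]

lemma toENNReal_neg_add_coe_le (c : ℝ) (d : ℝ≥0∞) :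
    (-((c : EReal) + d)).toENNReal ≤ ENNReal.ofReal (-c) := by
  rw [← EReal.real_coe_toENNReal, EReal.coe_neg]
  apply EReal.toENNReal_le_toENNReal
  rw [EReal.neg_le_neg_iff]
  exact le_add_of_nonneg_right (EReal.coe_ennreal_nonneg d)

/-- The hypothesis is an identity between positive and negative parts in which nothing is
subtracted, so it can be integrated, summed or conditioned term by term. Since only `P` and `d` may
be infinite, the subtraction can be carried out afterwards. -/
lemma coe_sub_coe_eq_of_add_eq {P N yp yn d : ℝ≥0∞} (h : P + yn = N + (yp + d)) (hN : N ≠ ⊤)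
    (hyp : yp ≠ ⊤) (hyn : yn ≠ ⊤) :
    (P : EReal) - (N : EReal) = ((yp.toReal - yn.toReal : ℝ) : EReal) + (d : EReal) := by
  lift N to NNReal using hN
  lift yp to NNReal using hyp
  lift yn to NNReal using hyn
  induction d using ENNReal.recTopCoe with
  | top =>
    have : P = ⊤ := by simpa using h
    subst this
    rfl
  | coe d =>
    have hP : P ≠ ⊤ := by
      rintro rfl
      simp only [top_add] at h
      exact absurd h.symm (by norm_cast)
    lift P to NNReal using hP
    have h' : (P : ℝ) + yn = N + (yp + d) := by exact_mod_cast h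
    change ((P : ℝ) : EReal) - ((N : ℝ) : EReal) = ((yp - yn : ℝ) : EReal) + ((d : ℝ) : EReal)
    rw [← EReal.coe_sub, ← EReal.coe_add]
    congr 1
    linarith

/-! ### Expectations and sums of a real and a nonnegative part -/

lemma eExp_add_coe {Ω : Type*} [MeasurableSpace Ω] {μ : Measure Ω} {f : Ω → EReal} {c : Ω → ℝ}
    {d : Ω → ℝ≥0∞} (hc : Integrable c μ) (hd : AEMeasurable d μ)
    (hf : ∀ᵐ ω ∂μ, f ω = (c ω : EReal) + (d ω : EReal)) :
    eExp μ f = ((∫ ω, c ω ∂μ : ℝ) : EReal) + ((∫⁻ ω, d ω ∂μ : ℝ≥0∞) : EReal) := by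
  have hp : ∫⁻ ω, ENNReal.ofReal (c ω) ∂μ ≠ ⊤ := hc.lintegral_lt_top.ne
  have hn : ∫⁻ ω, ENNReal.ofReal (-c ω) ∂μ ≠ ⊤ := hc.neg.lintegral_lt_top.ne
  have mc : AEMeasurable c μ := hc.1.aemeasurable
  have mn : AEMeasurable (fun ω => ENNReal.ofReal (-c ω)) μ := mc.neg.ennreal_ofReal
  have mpd : AEMeasurable (fun ω => ENNReal.ofReal (c ω) + d ω) μ := mc.ennreal_ofReal.add hd
  rw [integral_eq_lintegral_pos_part_sub_lintegral_neg_part hc]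
  refine coe_sub_coe_eq_of_add_eq ?_ ?_ hp hn
  · rw [← lintegral_add_right' _ mn, ← lintegral_add_right' _ hd,
      ← lintegral_add_right' _ mpd]
    refine lintegral_congr_ae ?_
    filter_upwards [hf] with ω hω
    rw [hω]
    exact toENNReal_add_coe _ _
  · refine ne_top_of_le_ne_top hn (lintegral_mono_ae ?_)
    filter_upwards [hf] with ω hω
    rw [hω]
    exact toENNReal_neg_add_coe_le _ _

lemma eExp_neg_add_coe {Ω : Type*} [MeasurableSpace Ω] {μ : Measure Ω} {f : Ω → EReal} {c : Ω → ℝ}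
    {d : Ω → ℝ≥0∞} (hc : Integrable c μ) (hd : AEMeasurable d μ)
    (hf : ∀ᵐ ω ∂μ, f ω = -((c ω : EReal) + (d ω : EReal))) :
    eExp μ f = -(((∫ ω, c ω ∂μ : ℝ) : EReal) + ((∫⁻ ω, d ω ∂μ : ℝ≥0∞) : EReal)) := by
  have hn : ∫⁻ ω, (f ω).toENNReal ∂μ ≠ ⊤ := by
    refine ne_top_of_le_ne_top hc.neg.lintegral_lt_top.ne (lintegral_mono_ae ?_)
    filter_upwards [hf] with ω hω
    rw [hω]
    exact toENNReal_neg_add_coe_le _ _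
  rw [← eExp_add_coe (f := fun ω => -f ω) hc hd (hf.mono fun ω hω => by rw [hω, neg_neg])]
  unfold eExp
  -- Negating a difference of extended reals requires excluding `⊤ - ⊤`; here the positive part is
  -- finite.
  rw [EReal.neg_sub (.inl (EReal.coe_ennreal_ne_bot _)) (.inr ?_)]
  · simp only [neg_neg]
    rw [sub_eq_add_neg, add_comm]
  · simpa using hn

lemma eSum_add_coe {ι : Type*} {c : ι → ℝ} {d : ι → ℝ≥0∞} (hc : Summable c) :
    eSum (fun i => (c i : EReal) + (d i : EReal)) =
      ((∑' i, c i : ℝ) : EReal) + ((∑' i, d i : ℝ≥0∞) : EReal) := by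
  have key : ∀ {c : ι → ℝ}, Summable c → ∑' i, ENNReal.ofReal (c i) ≠ ⊤ := by
    intro c hc
    have h1 : ∀ i, ENNReal.ofReal (c i) ≤ ENNReal.ofReal |c i| :=
      fun i => ENNReal.ofReal_le_ofReal (le_abs_self _)
    refine ne_top_of_le_ne_top ?_ (ENNReal.tsum_le_tsum h1)
    rw [← ENNReal.ofReal_tsum_of_nonneg (fun i => abs_nonneg _) hc.abs]
    exact ENNReal.ofReal_ne_top
  have hp := key hc
  have hn : ∑' i, ENNReal.ofReal (-c i) ≠ ⊤ := key hc.neg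
  have hsum : ∑' i, c i =
      (∑' i, ENNReal.ofReal (c i)).toReal - (∑' i, ENNReal.ofReal (-c i)).toReal := by
    rw [ENNReal.tsum_toReal_eq (fun i => ENNReal.ofReal_ne_top),
      ENNReal.tsum_toReal_eq (fun i => ENNReal.ofReal_ne_top),
      ← (ENNReal.summable_toReal hp).tsum_sub (ENNReal.summable_toReal hn)]
    exact tsum_congr fun i => (toReal_ofReal_sub_toReal_ofReal_neg _).symm
  rw [hsum]
  refine coe_sub_coe_eq_of_add_eq ?_ ?_ hp hn
  · rw [← ENNReal.tsum_add, ← ENNReal.tsum_add, ← ENNReal.tsum_add]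
    exact tsum_congr fun i => toENNReal_add_coe _ _
  · exact ne_top_of_le_ne_top hn (ENNReal.tsum_le_tsum fun i => toENNReal_neg_add_coe_le _ _)

lemma eSum_neg_add_coe {ι : Type*} {c : ι → ℝ} {d : ι → ℝ≥0∞} (hc : Summable c) :
    eSum (fun i => -((c i : EReal) + (d i : EReal))) =
      -(((∑' i, c i : ℝ) : EReal) + ((∑' i, d i : ℝ≥0∞) : EReal)) := by
  have hn : ∑' i, (-((c i : EReal) + (d i : EReal))).toENNReal ≠ ⊤ := by
    refine ne_top_of_le_ne_top ?_ (ENNReal.tsum_le_tsum fun i => toENNReal_neg_add_coe_le _ _)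
    have h1 : ∀ i, ENNReal.ofReal (-c i) ≤ ENNReal.ofReal |c i| :=
      fun i => ENNReal.ofReal_le_ofReal (neg_le_abs _)
    refine ne_top_of_le_ne_top ?_ (ENNReal.tsum_le_tsum h1)
    rw [← ENNReal.ofReal_tsum_of_nonneg (fun i => abs_nonneg _) hc.abs]
    exact ENNReal.ofReal_ne_top
  rw [← eSum_add_coe hc]
  unfold eSum
  rw [EReal.neg_sub (.inl (EReal.coe_ennreal_ne_bot _)) (.inr ?_)]
  · simp only [neg_neg]
    rw [sub_eq_add_neg, add_comm]
  · simpa using hn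

/-! ### Conditional Lebesgue expectations -/

lemma eCondExp_add_coe {Ω : Type*} {m mΩ : MeasurableSpace Ω} {P : Measure Ω}
    {f : Ω → EReal} {Y : Ω → ℝ} {D : Ω → ℝ≥0∞} (hY : Integrable Y P)
    (hD : AEMeasurable D P)
    (hf : ∀ᵐ ω ∂P, f ω = (Y ω : EReal) + (D ω : EReal)) :
    ∀ᵐ ω ∂P, eCondExp P m f ω = ((P[Y | m]) ω : EReal) + ((condLExp m P D ω : ℝ≥0∞) : EReal) := by
  have hp : ∫⁻ ω, ENNReal.ofReal (Y ω) ∂P ≠ ⊤ := hY.lintegral_lt_top.ne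
  have hn : ∫⁻ ω, ENNReal.ofReal (-Y ω) ∂P ≠ ⊤ := hY.neg.lintegral_lt_top.ne
  have mY : AEMeasurable Y P := hY.1.aemeasurable
  have mp : AEMeasurable (fun ω => ENNReal.ofReal (Y ω)) P := mY.ennreal_ofReal
  have mn : AEMeasurable (fun ω => ENNReal.ofReal (-Y ω)) P := mY.neg.ennreal_ofReal
  have hN : ∀ᵐ ω ∂P, (-f ω).toENNReal ≤ ENNReal.ofReal (-Y ω) := by
    filter_upwards [hf] with ω hω
    rw [hω]
    exact toENNReal_neg_add_coe_le _ _
  have hcong : condLExp m P ((fun ω => (f ω).toENNReal) + fun ω => ENNReal.ofReal (-Y ω)) =ᵐ[P]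
      condLExp m P ((fun ω => (-f ω).toENNReal) + ((fun ω => ENNReal.ofReal (Y ω)) + D)) := by
    apply condLExp_congr_ae
    filter_upwards [hf] with ω hω
    simp only [Pi.add_apply]
    rw [hω]
    exact toENNReal_add_coe _ _
  have hsub : P[Y | m] =ᵐ[P] P[fun ω => (ENNReal.ofReal (Y ω)).toReal | m] -
      P[fun ω => (ENNReal.ofReal (-Y ω)).toReal | m] := by
    refine EventuallyEq.trans (condExp_congr_ae ?_)
      (condExp_sub (integrable_toReal_of_lintegral_ne_top mp hp)
        (integrable_toReal_of_lintegral_ne_top mn hn) m)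
    exact Eventually.of_forall fun ω => (toReal_ofReal_sub_toReal_ofReal_neg _).symm
  filter_upwards [hcong, hsub, condLExp_add_right (mΩ := m) (fun ω => (f ω).toENNReal) mn,
    condLExp_add_right (mΩ := m) (fun ω => (-f ω).toENNReal) (mp.add hD),
    condLExp_add_right (mΩ := m) (fun ω => ENNReal.ofReal (Y ω)) hD,
    toReal_condLExp m mp hp, toReal_condLExp m mn hn,
    condLExp_mono (mΩ := m) hN, condLExp_ne_top (mΩ := m) hp, condLExp_ne_top (mΩ := m) hn]
    with ω h1 h2 h3 h4 h5 h6 h7 h8 h9 h10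
  rw [h2, Pi.sub_apply, ← h6, ← h7]
  refine coe_sub_coe_eq_of_add_eq ?_ (ne_top_of_le_ne_top h10 h8) h9 h10
  rw [h3, h4] at h1
  simp only [Pi.add_apply] at h1 h5
  rw [h1, h5]

lemma measurable_eCondExp {Ω : Type*} {m mΩ : MeasurableSpace Ω} (P : Measure Ω) (f : Ω → EReal) :
    Measurable[m] (eCondExp P m f) := by
  unfold eCondExp
  simp_rw [sub_eq_add_neg]
  exact ((measurable_condLExp _ _ _).coe_ereal_ennreal).add
    (continuous_neg.measurable.comp (measurable_condLExp _ _ _).coe_ereal_ennreal)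

/-- The measures with densities `f` and `condLExp m P f` agree on `m`, so they give the same
integral to every `m`-measurable function. No integrability of `f` is needed. -/
lemma condLExp_mul_left {Ω : Type*} {m mΩ : MeasurableSpace Ω} (hm : m ≤ mΩ) {P : Measure Ω}
    [IsFiniteMeasure P] {a f : Ω → ℝ≥0∞} (ha : Measurable[m] a) (hf : Measurable f) :
    condLExp m P (a * f) =ᵐ[P] a * condLExp m P f := by
  refine (ae_eq_condLExp hm P _ (ha.mul (measurable_condLExp m P f)) fun s hs => ?_).symm
  have htrim : (P.withDensity f).trim hm = (P.withDensity (condLExp m P f)).trim hm := by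
    refine @Measure.ext _ m _ _ fun t ht => ?_
    rw [trim_measurableSet_eq hm ht, trim_measurableSet_eq hm ht, withDensity_apply _ (hm t ht),
      withDensity_apply _ (hm t ht), setLIntegral_condLExp hm P f ht]
  have hsa : Measurable[m] (s.indicator a) := ha.indicator hs
  have key : ∀ g : Ω → ℝ≥0∞, Measurable g → ∫⁻ ω in s, (a * g) ω ∂P =
      ∫⁻ ω, s.indicator a ω ∂((P.withDensity g).trim hm) := by
    intro g hg
    rw [lintegral_trim hm hsa, lintegral_withDensity_eq_lintegral_mul _ hg (hsa.mono hm le_rfl),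
      ← lintegral_indicator (hm s hs)]
    refine lintegral_congr fun ω => ?_
    by_cases h : ω ∈ s <;> simp [h, mul_comm]
  rw [key _ (measurable_condLExp' m P f), key _ hf, htrim]

/-- The partial sums telescope, and `min h` commutes with suprema. -/
lemma tsum_min_succ_tsub {h : ℝ≥0∞} {s : ℕ → ℝ≥0∞} (h0 : s 0 = 0) (hs : Monotone s) :
    ∑' k, (min h (s (k + 1)) - min h (s k)) = min h (⨆ n, s n) := by
  have hfin : ∀ n, ∑ k ∈ Finset.range n, (min h (s (k + 1)) - min h (s k)) = min h (s n) := by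
    intro n
    induction n with
    | zero => simp [h0]
    | succ n ih =>
      rw [Finset.sum_range_succ, ih,
        add_tsub_cancel_of_le (min_le_min le_rfl (hs (Nat.le_succ n)))]
  rw [ENNReal.tsum_eq_iSup_nat]
  simp_rw [hfin]
  exact (inf_iSup_eq h s).symm

/-- A nonnegative random variable `D` can be shrunk to one with any prescribed conditional
expectation below that of `D`. -/
lemma exists_le_condLExp_eq {Ω : Type*} {m mΩ : MeasurableSpace Ω} (hm : m ≤ mΩ) {P : Measure Ω}
    [IsFiniteMeasure P] {D h : Ω → ℝ≥0∞} (hD : Measurable D) (hh : Measurable[m] h)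
    (hle : h ≤ᵐ[P] condLExp m P D) :
    ∃ G : Ω → ℝ≥0∞, Measurable G ∧ (∀ ω, G ω ≤ D ω) ∧ condLExp m P G =ᵐ[P] h := by
  -- Scaling `D` by `h / E[D | m]` fails where `E[D | m]` is infinite. So `D` is cut into layers of
  -- height at most one, whose conditional expectations are almost surely finite.
  let E : ℕ → Ω → ℝ≥0∞ := fun k ω => min (D ω) ((k + 1 : ℕ) : ℝ≥0∞) - min (D ω) (k : ℝ≥0∞)
  have hE : ∀ k, Measurable (E k) := fun k =>
    (hD.min measurable_const).sub (hD.min measurable_const)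
  have hED : ∀ ω, ∑' k, E k ω = D ω := by
    intro ω
    have := tsum_min_succ_tsub (h := D ω) (s := fun n : ℕ => (n : ℝ≥0∞)) (by simp)
      (fun a b hab => Nat.cast_le.2 hab)
    simp only [ENNReal.iSup_natCast, le_top, inf_of_le_left] at this
    exact this
  have hEfin : ∀ k, ∫⁻ ω, E k ω ∂P ≠ ⊤ := by
    intro k
    refine ne_top_of_le_ne_top (b := ((k + 1 : ℕ) : ℝ≥0∞) * P Set.univ) (by finiteness) ?_
    rw [← lintegral_const]
    exact lintegral_mono fun ω => tsub_le_self.trans (min_le_right _ _)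
  let e : ℕ → Ω → ℝ≥0∞ := fun k => condLExp m P (E k)
  have he : ∀ k, Measurable[m] (e k) := fun k => measurable_condLExp m P (E k)
  let s : ℕ → Ω → ℝ≥0∞ := fun k ω => ∑ j ∈ Finset.range k, e j ω
  have hs : ∀ k, Measurable[m] (s k) := fun k => Finset.measurable_fun_sum _ fun j _ => he j
  -- The part of `h` assigned to layer `k` when the layers are filled greedily from the bottom.
  let a : ℕ → Ω → ℝ≥0∞ := fun k ω => min (h ω) (s (k + 1) ω) - min (h ω) (s k ω)
  have ha : ∀ k, Measurable[m] (a k) := fun k =>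
    (hh.min (hs (k + 1))).sub (hh.min (hs k))
  have hae : ∀ k ω, a k ω ≤ e k ω := by
    intro k ω
    refine tsub_le_iff_left.2 ?_
    have : s (k + 1) ω = s k ω + e k ω := Finset.sum_range_succ _ _
    rw [this, min_add]
    exact min_le_min le_self_add le_rfl
  -- The factor that scales layer `k` to conditional mean `a k`. The cap never binds, because `a k ≤
  -- e k`, but it makes `b k ≤ 1` immediate.
  let b : ℕ → Ω → ℝ≥0∞ := fun k ω => min (a k ω / e k ω) 1
  have hb : ∀ k, Measurable[m] (b k) := fun k => ((ha k).div (he k)).min measurable_const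
  have hba : ∀ k ω, e k ω ≠ ⊤ → b k ω * e k ω = a k ω := by
    intro k ω htop
    have h1 : a k ω / e k ω ≤ 1 := ENNReal.div_le_of_le_mul (by simpa using hae k ω)
    simp only [b, min_eq_left h1]
    rcases eq_or_ne (e k ω) 0 with h0 | h0
    · have := hae k ω
      rw [h0] at this ⊢
      simpa using (le_antisymm this zero_le).symm
    · exact ENNReal.div_mul_cancel h0 htop
  have hbE : ∀ k, Measurable (b k * E k) := fun k => ((hb k).mono hm le_rfl).mul (hE k)
  refine ⟨fun ω => ∑' k, b k ω * E k ω, Measurable.tsum hbE, fun ω => ?_, ?_⟩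
  · rw [← hED ω]
    refine ENNReal.tsum_le_tsum fun k => ?_
    exact mul_le_of_le_one_left' (min_le_right _ _)
  have h1 : condLExp m P (∑' k, b k * E k) =ᵐ[P] ∑' k, condLExp m P (b k * E k) :=
    condLExp_tsum m fun k => (hbE k).aemeasurable
  have h2 : condLExp m P (∑' k, E k) =ᵐ[P] ∑' k, e k :=
    condLExp_tsum m fun k => (hE k).aemeasurable
  have h3 : ∀ᵐ ω ∂P, ∀ k, condLExp m P (b k * E k) ω = b k ω * e k ω :=
    ae_all_iff.2 fun k => condLExp_mul_left hm (hb k) (hE k)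
  have h4 : ∀ᵐ ω ∂P, ∀ k, e k ω ≠ ⊤ := ae_all_iff.2 fun k => condLExp_ne_top (hEfin k)
  have hG : (fun ω => ∑' k, b k ω * E k ω) = ∑' k, b k * E k := by
    ext ω; rw [ENNReal.tsum_apply]; rfl
  have hD' : D = ∑' k, E k := by
    ext ω; rw [ENNReal.tsum_apply, hED]
  rw [hG]
  rw [← hD'] at h2
  filter_upwards [h1, h2, h3, h4, hle] with ω h1 h2 h3 h4 hle
  rw [h1, ENNReal.tsum_apply]
  rw [ENNReal.tsum_apply, ENNReal.tsum_eq_iSup_nat] at h2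
  calc ∑' k, condLExp m P (b k * E k) ω = ∑' k, a k ω :=
        tsum_congr fun k => (h3 k).trans (hba k ω (h4 k))
    _ = min (h ω) (⨆ n, s n ω) :=
        tsum_min_succ_tsub (s := fun n => s n ω) (by simp [s])
          (fun i j hij => Finset.sum_le_sum_of_subset (Finset.range_mono hij))
    _ = h ω := min_eq_left (hle.trans h2.le)

/-! ### Conditioning on the covariates and on a value of the instrument -/

section Conditioning

variable {Ω 𝒳 𝒵 : Type*} [MeasurableSpace Ω] {μ : Measure Ω} [MeasurableSpace 𝒳] {X : Ω → 𝒳}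
  {Z : Ω → 𝒵}

lemma integrable_cond {V : Ω → ℝ} (hV : Integrable V μ) (s : Set Ω) :
    Integrable V (cond μ s) := by
  rcases eq_or_ne (μ s) 0 with h | h
  · simp [cond_eq_zero_of_meas_eq_zero h]
  · exact hV.restrict.smul_measure (ENNReal.inv_ne_top.2 h)

lemma measurable_probGiven (z : 𝒵) : Measurable[sigma X] (probGiven μ X Z z) :=
  stronglyMeasurable_condExp.measurable

lemma measurable_meanGiven (V : Ω → ℝ) (z : 𝒵) : Measurable[sigma X] (meanGiven μ X Z V z) :=
  stronglyMeasurable_condExp.measurable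

lemma probGiven_nonneg [Countable 𝒵] : ∀ᵐ ω ∂μ, ∀ z, 0 ≤ probGiven μ X Z z ω :=
  ae_all_iff.2 fun _ => condExp_nonneg
    (Eventually.of_forall fun _ => Set.indicator_nonneg (fun _ _ => zero_le_one) _)

lemma lintegral_eq_tsum_lintegral_preimage [MeasurableSpace 𝒵] [MeasurableSingletonClass 𝒵]
    [Countable 𝒵] (hZ : Measurable Z) (f : Ω → ℝ≥0∞) :
    ∫⁻ ω, f ω ∂μ = ∑' z, ∫⁻ ω in Z ⁻¹' {z}, f ω ∂μ := by
  rw [← lintegral_iUnion (fun z => hZ (measurableSet_singleton z))]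
  · rw [← Set.preimage_iUnion, Set.iUnion_of_singleton, Set.preimage_univ, setLIntegral_univ]
  · intro z z' h
    exact Disjoint.preimage Z (by simpa using h)

variable [IsProbabilityMeasure μ]

lemma lintegral_restrict_eq_mul_lintegral_cond (s : Set Ω) (f : Ω → ℝ≥0∞) :
    ∫⁻ ω in s, f ω ∂μ = μ s * ∫⁻ ω, f ω ∂(cond μ s) := by
  rw [ProbabilityTheory.cond, lintegral_smul_measure, smul_eq_mul, ← mul_assoc]
  rcases eq_or_ne (μ s) 0 with h | h
  · simp [h, Measure.restrict_eq_zero.2 h]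
  · rw [ENNReal.mul_inv_cancel h (measure_ne_top _ _), one_mul]

variable [MeasurableSpace 𝒵] [MeasurableSingletonClass 𝒵]

lemma integrable_indicator_one (hZ : Measurable Z) (z : 𝒵) :
    Integrable ((Z ⁻¹' {z}).indicator (fun _ => (1 : ℝ))) μ :=
  (integrable_const 1).indicator (hZ (measurableSet_singleton z))

/-- The bridge between `μ` and the conditional measures: pull the `σ(X)`-measurable factor out of
the conditional expectation, then integrate. -/
lemma lintegral_probGiven_mul (hX : Measurable X) (hZ : Measurable Z) (z : 𝒵) {f : Ω → ℝ≥0∞}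
    (hf : Measurable[sigma X] f) :
    ∫⁻ ω, ENNReal.ofReal (probGiven μ X Z z ω) * f ω ∂μ = ∫⁻ ω in Z ⁻¹' {z}, f ω ∂μ := by
  have hm : sigma X ≤ _ := hX.comap_le
  have hs : MeasurableSet (Z ⁻¹' {z}) := hZ (measurableSet_singleton z)
  have h1 := condLExp_ofReal (sigma X) (integrable_indicator_one (μ := μ) hZ z)
    (Eventually.of_forall fun _ => Set.indicator_nonneg (fun _ _ => zero_le_one) _)
  have hmeas : Measurable fun ω =>
      ENNReal.ofReal ((Z ⁻¹' {z}).indicator (fun _ => (1 : ℝ)) ω) :=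
    (measurable_const.indicator hs).ennreal_ofReal
  have h2 := condLExp_mul_left hm (P := μ) hf hmeas
  calc ∫⁻ ω, ENNReal.ofReal (probGiven μ X Z z ω) * f ω ∂μ
      = ∫⁻ ω, condLExp (sigma X) μ
          (f * fun ω => ENNReal.ofReal ((Z ⁻¹' {z}).indicator (fun _ => (1 : ℝ)) ω)) ω ∂μ := by
        refine lintegral_congr_ae ?_
        filter_upwards [h1, h2] with ω h1 h2
        rw [h2, Pi.mul_apply, h1, mul_comm]
        rfl
    _ = ∫⁻ ω, f ω * ENNReal.ofReal ((Z ⁻¹' {z}).indicator (fun _ => (1 : ℝ)) ω) ∂μ :=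
        lintegral_condLExp hm μ _
    _ = ∫⁻ ω in Z ⁻¹' {z}, f ω ∂μ := by
        rw [← lintegral_indicator hs]
        refine lintegral_congr fun ω => ?_
        by_cases h : ω ∈ Z ⁻¹' {z} <;> simp [h]

/-- Events in `σ(X)` that are almost sure given `Z = z` are almost sure where
`P(Z = z | X) > 0`. -/
lemma ae_of_ae_cond (hX : Measurable X) (hZ : Measurable Z) {z : 𝒵} {p : Ω → Prop}
    (hp : MeasurableSet[sigma X] {ω | p ω}) (h : ∀ᵐ ω ∂(cond μ (Z ⁻¹' {z})), p ω) :
    ∀ᵐ ω ∂μ, 0 < probGiven μ X Z z ω → p ω := by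
  have hf : Measurable[sigma X] ({ω | p ω}ᶜ.indicator (fun _ => (1 : ℝ≥0∞))) :=
    measurable_const.indicator hp.compl
  have h0 := lintegral_probGiven_mul (μ := μ) hX hZ z hf
  have hm : sigma X ≤ _ := hX.comap_le
  rw [lintegral_restrict_eq_mul_lintegral_cond, lintegral_indicator (hm _ hp.compl)] at h0
  have h1 : cond μ (Z ⁻¹' {z}) {ω | p ω}ᶜ = 0 := h
  have hpf : Measurable fun ω =>
      ENNReal.ofReal (probGiven μ X Z z ω) * {ω | p ω}ᶜ.indicator (fun _ => (1 : ℝ≥0∞)) ω :=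
    ((measurable_probGiven z).ennreal_ofReal.mul hf).mono hm le_rfl
  rw [setLIntegral_measure_zero _ _ h1, mul_zero, lintegral_eq_zero_iff hpf] at h0
  filter_upwards [h0] with ω hω hpos
  by_contra hc
  simp [hc] at hω
  linarith

/-- Testing `lintegral_probGiven_mul` on the indicator of the event where the conditional
probability is not positive makes its left side vanish. -/
lemma ae_cond_probGiven_pos (hX : Measurable X) (hZ : Measurable Z) (z : 𝒵) :
    ∀ᵐ ω ∂(cond μ (Z ⁻¹' {z})), 0 < probGiven μ X Z z ω := by
  have hs : MeasurableSet[sigma X] {ω | probGiven μ X Z z ω ≤ 0} :=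
    measurableSet_le (measurable_probGiven z) measurable_const
  have hf : Measurable[sigma X]
      ({ω | probGiven μ X Z z ω ≤ 0}.indicator (fun _ => (1 : ℝ≥0∞))) :=
    measurable_const.indicator hs
  have h0 := lintegral_probGiven_mul (μ := μ) hX hZ z hf
  have hm : sigma X ≤ _ := hX.comap_le
  rw [lintegral_indicator (hm _ hs), lintegral_congr (g := fun _ => 0)] at h0
  · have h2 : (μ.restrict (Z ⁻¹' {z})) {ω | probGiven μ X Z z ω ≤ 0} = 0 := by
      simpa using h0.symm
    have h3 : cond μ (Z ⁻¹' {z}) {ω | probGiven μ X Z z ω ≤ 0} = 0 :=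
      Measure.smul_absolutelyContinuous h2
    filter_upwards [measure_eq_zero_iff_ae_notMem.1 h3] with ω hω
    simpa using hω
  · intro ω
    by_cases h : probGiven μ X Z z ω ≤ 0
    · simp [ENNReal.ofReal_of_nonpos h]
    · simp [h]

/-- On `{Z = z}`, `V` and its mean given `X, Z = z` have equal integrals over every event of `σ(X)`,
because `μ` restricted to the fibre is a multiple of the conditional measure. The mean then factors
out. -/
lemma condExp_indicator_preimage (hX : Measurable X) (hZ : Measurable Z) {V : Ω → ℝ}
    (hV : Integrable V μ) (z : 𝒵) :
    μ[(Z ⁻¹' {z}).indicator V | sigma X] =ᵐ[μ]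
      fun ω => probGiven μ X Z z ω * meanGiven μ X Z V z ω := by
  have hm : sigma X ≤ _ := hX.comap_le
  have hs : MeasurableSet (Z ⁻¹' {z}) := hZ (measurableSet_singleton z)
  set S := Z ⁻¹' {z} with hS
  have hM : Integrable (S.indicator (meanGiven μ X Z V z)) μ := by
    rw [integrable_indicator_iff hs, IntegrableOn]
    rcases eq_or_ne (μ S) 0 with h | h
    · simp [Measure.restrict_eq_zero.2 h]
    · have : μ.restrict S = (μ S) • cond μ S := by
        rw [ProbabilityTheory.cond, smul_smul, ENNReal.mul_inv_cancel h (measure_ne_top _ _), one_smul]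
      rw [this]
      exact integrable_condExp.smul_measure (measure_ne_top _ _)
  have hmul : (fun ω => S.indicator (fun _ => (1 : ℝ)) ω) * meanGiven μ X Z V z =
      S.indicator (meanGiven μ X Z V z) := by
    ext ω
    by_cases h : ω ∈ S <;> simp [h]
  have h1 := condExp_mul_of_stronglyMeasurable_right (μ := μ) (m := sigma X)
    (f := S.indicator (fun _ => (1 : ℝ))) (g := meanGiven μ X Z V z)
    stronglyMeasurable_condExp (by rw [hmul]; exact hM) (integrable_indicator_one hZ z)
  rw [hmul] at h1
  refine EventuallyEq.trans (ae_eq_condExp_of_forall_setIntegral_eq hm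
    (hV.indicator hs) (fun _ _ _ => integrable_condExp.integrableOn) (fun t ht _ => ?_)
    stronglyMeasurable_condExp.aestronglyMeasurable).symm h1
  rw [setIntegral_condExp hm hM ht, integral_indicator hs, integral_indicator hs]
  have hset : ∀ f : Ω → ℝ, ∫ ω in S, f ω ∂(μ.restrict t) =
      (μ S).toReal * ∫ ω in t, f ω ∂(cond μ S) := by
    intro f
    rw [Measure.restrict_restrict hs, ProbabilityTheory.cond, Measure.restrict_smul, integral_smul_measure,
      Measure.restrict_restrict (hm t ht), Set.inter_comm t S, smul_eq_mul, ENNReal.toReal_inv,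
      ← mul_assoc]
    rcases eq_or_ne (μ S) 0 with h | h
    · simp [Measure.restrict_eq_zero.2 (measure_mono_null Set.inter_subset_left h)]
    · rw [mul_inv_cancel₀ (ENNReal.toReal_ne_zero.2 ⟨h, measure_ne_top _ _⟩), one_mul]
  rw [hset, hset]
  congr 1
  exact setIntegral_condExp hm (integrable_cond hV S) ht

/-- The law of total expectation over the fibres of `Z`. Almost sure absolute convergence follows
because the `L¹` norms of the pieces of `V` have a finite sum and conditional expectation contracts
`L¹`. -/
lemma hasSum_probGiven_mul_meanGiven [Countable 𝒵] (hX : Measurable X) (hZ : Measurable Z)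
    {V : Ω → ℝ} (hV : Integrable V μ) :
    ∀ᵐ ω ∂μ, HasSum (fun z => probGiven μ X Z z ω * meanGiven μ X Z V z ω)
      ((μ[V | sigma X]) ω) := by
  have hs : ∀ z, MeasurableSet (Z ⁻¹' {z}) := fun z => hZ (measurableSet_singleton z)
  have hmeas : ∀ z, AEStronglyMeasurable ((Z ⁻¹' {z}).indicator V) μ := fun z =>
    hV.1.indicator (hs z)
  have hfin : ∑' z, ∫⁻ ω, ‖(Z ⁻¹' {z}).indicator V ω‖ₑ ∂μ ≠ ⊤ := by
    rw [← lintegral_tsum fun z => (hmeas z).enorm]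
    refine ne_top_of_le_ne_top hV.2.ne (lintegral_mono fun ω => ?_)
    rw [tsum_eq_single (Z ω) fun z hz => by simp [hz.symm]]
    simp
  have hVsum : (fun ω => ∑' z, (Z ⁻¹' {z}).indicator V ω) = V := by
    ext ω
    rw [tsum_eq_single (Z ω) fun z hz => by simp [hz.symm]]
    simp
  have h1 := condExp_tsum (m := sigma X) hmeas hfin
  rw [hVsum] at h1
  have h2 : ∀ᵐ ω ∂μ, ∀ z, (μ[(Z ⁻¹' {z}).indicator V | sigma X]) ω =
      probGiven μ X Z z ω * meanGiven μ X Z V z ω :=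
    ae_all_iff.2 fun z => condExp_indicator_preimage hX hZ hV z
  have h3 : ∑' z, ∫⁻ ω, ‖(μ[(Z ⁻¹' {z}).indicator V | sigma X]) ω‖ₑ ∂μ ≠ ⊤ := by
    refine ne_top_of_le_ne_top hfin (ENNReal.tsum_le_tsum fun z => ?_)
    rw [← eLpNorm_one_eq_lintegral_enorm, ← eLpNorm_one_eq_lintegral_enorm]
    exact eLpNorm_condExp_le_eLpNorm _ le_rfl
  rw [← lintegral_tsum fun z => integrable_condExp.1.enorm] at h3
  have h4 := ae_lt_top' (AEMeasurable.tsum fun z => integrable_condExp.1.enorm) h3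
  filter_upwards [h1, h2, h4] with ω h1 h2 h4
  rw [h1]
  simp_rw [h2] at h4 ⊢
  refine Summable.hasSum (Summable.of_nnnorm ?_)
  exact ENNReal.tsum_coe_ne_top_iff_summable.1 h4.ne

lemma probGiven_ae_eq_of_indepFun [Countable 𝒵] (hX : Measurable X) (hZ : Measurable Z) (h : IndepFun X Z μ) :
    ∀ᵐ ω ∂μ, ∀ z, probGiven μ X Z z ω = μ.real (Z ⁻¹' {z}) := by
  refine ae_all_iff.2 fun z => ?_
  have hs : MeasurableSet[MeasurableSpace.comap Z inferInstance] (Z ⁻¹' {z}) :=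
    ⟨{z}, measurableSet_singleton z, rfl⟩
  have hsm : StronglyMeasurable[MeasurableSpace.comap Z inferInstance]
      ((Z ⁻¹' {z}).indicator fun _ => (1 : ℝ)) := stronglyMeasurable_const.indicator hs
  have := condExp_indep_eq (μ := μ) hZ.comap_le hX.comap_le hsm
    ((IndepFun_iff_Indep _ _ _).1 h).symm
  filter_upwards [this] with ω hω
  refine hω.trans ?_
  rw [integral_indicator (hZ (measurableSet_singleton z))]
  simp

end Conditioning

/-! ### Differences between an extended real and a real number. -/

lemma coe_add_toENNReal_sub {a : EReal} {b : ℝ} (h : (b : EReal) ≤ a) :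
    (b : EReal) + ((a - b).toENNReal : EReal) = a := by
  rw [EReal.coe_toENNReal ((EReal.sub_nonneg (.inr (EReal.coe_ne_top b))
    (.inr (EReal.coe_ne_bot b))).2 h), add_comm, EReal.sub_add_cancel]

lemma toENNReal_coe_add_sub (b : ℝ) (d : ℝ≥0∞) :
    ((b : EReal) + (d : EReal) - (b : EReal)).toENNReal = d := by
  rw [EReal.add_sub_cancel_left, EReal.toENNReal_coe]

lemma coe_toReal_ennreal {d : ℝ≥0∞} (h : d ≠ ⊤) : ((d.toReal : ℝ) : EReal) = (d : EReal) := by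
  lift d to NNReal using h
  rfl

/-! ### Envelopes of conditional expectations along a relation on the instrument -/

section Envelope

variable {Ω 𝒳 𝒵 : Type*} [MeasurableSpace Ω] [MeasurableSpace 𝒳]

/-- The infimum of `E[S | X, Z = z₂]` over the `z₂` with `r z z₂` and `P(Z = z₂ | X) > 0`. -/
noncomputable def upperEnv (r : 𝒵 → 𝒵 → Prop) (μ : Measure Ω) (X : Ω → 𝒳) (Z : Ω → 𝒵)
    (S : Ω → EReal) (z : 𝒵) (ω : Ω) : EReal :=
  ⨅ z₂ ∈ {z₂ : 𝒵 | r z z₂ ∧ 0 < probGiven μ X Z z₂ ω},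
    eCondExp (ProbabilityTheory.cond μ (Z ⁻¹' {z₂})) (sigma X) S ω

/-- The amount by which the envelope of `S` exceeds `E[Y | X, Z = z]`. -/
noncomputable def gap (r : 𝒵 → 𝒵 → Prop) (μ : Measure Ω) (X : Ω → 𝒳) (Z : Ω → 𝒵)
    (S : Ω → EReal) (Y : Ω → ℝ) (z : 𝒵) (ω : Ω) : ℝ≥0∞ :=
  (upperEnv r μ X Z S z ω - (meanGiven μ X Z Y z ω : EReal)).toENNReal

/-- `E[Y | X, Z = z]` is monotone in `z` along the relation `r`. -/
def MonotoneAlong (r : 𝒵 → 𝒵 → Prop) (μ : Measure Ω) (X : Ω → 𝒳) (Z : Ω → 𝒵) (Y : Ω → ℝ) :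
    Prop :=
  ∀ z z₂ : 𝒵, r z z₂ → ∀ᵐ ω ∂μ, 0 < probGiven μ X Z z ω → 0 < probGiven μ X Z z₂ ω →
    meanGiven μ X Z Y z ω ≤ meanGiven μ X Z Y z₂ ω

variable {μ : Measure Ω} {X : Ω → 𝒳} {Z : Ω → 𝒵} {r : 𝒵 → 𝒵 → Prop} {S : Ω → EReal} {Y : Ω → ℝ}

lemma measurable_upperEnv [Countable 𝒵] (z : 𝒵) :
    Measurable[sigma X] (upperEnv r μ X Z S z) := by
  refine Measurable.iInf fun z₂ => ?_
  have hE : Measurable[sigma X]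
      (eCondExp (ProbabilityTheory.cond μ (Z ⁻¹' {z₂})) (sigma X) S) :=
    measurable_eCondExp _ _
  by_cases hr : r z z₂
  · have hset : MeasurableSet[sigma X] {ω | 0 < probGiven μ X Z z₂ ω} :=
      measurableSet_lt measurable_const (measurable_probGiven z₂)
    classical
    -- The index set of the infimum depends on `ω`; inadmissible indices are given the neutral value
    -- `⊤`.
    have hite : Measurable[sigma X] fun ω => if 0 < probGiven μ X Z z₂ ω then
        eCondExp (ProbabilityTheory.cond μ (Z ⁻¹' {z₂})) (sigma X) S ω else ⊤ :=
      Measurable.ite hset hE measurable_const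
    convert! hite using 2 with ω
    by_cases h : 0 < probGiven μ X Z z₂ ω <;> simp [hr, h]
  · simp [hr]

lemma measurable_gap [Countable 𝒵] (z : 𝒵) : Measurable[sigma X] (gap r μ X Z S Y z) := by
  unfold gap
  simp_rw [sub_eq_add_neg]
  exact ((measurable_upperEnv z).add (continuous_neg.measurable.comp
    (measurable_meanGiven Y z).coe_real_ereal)).ereal_toENNReal

/-- By transitivity, every competitor for `z₂` is one for `z`. Hence means raised to the envelope
remain monotone. -/
lemma upperEnv_mono (hr : ∀ a b c, r a b → r b c → r a c) {z z₂ : 𝒵} (h : r z z₂) (ω : Ω) :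
    upperEnv r μ X Z S z ω ≤ upperEnv r μ X Z S z₂ ω :=
  iInf_le_iInf_of_subset fun _ hc => ⟨hr _ _ _ h hc.1, hc.2⟩

lemma eCondExp_cond_eq (hY : Integrable Y μ) (hS : Measurable S)
    (hmY : Measurable Y) (hYS : ∀ᵐ ω ∂μ, (Y ω : EReal) ≤ S ω) (z : 𝒵) :
    ∀ᵐ ω ∂(ProbabilityTheory.cond μ (Z ⁻¹' {z})),
      eCondExp (ProbabilityTheory.cond μ (Z ⁻¹' {z})) (sigma X) S ω =
        (meanGiven μ X Z Y z ω : EReal) + (condLExp (sigma X)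
          (ProbabilityTheory.cond μ (Z ⁻¹' {z})) (fun ω => (S ω - Y ω).toENNReal) ω : EReal) := by
  refine eCondExp_add_coe (integrable_cond hY _) ?_ ?_
  · simp_rw [sub_eq_add_neg]
    exact ((hS.add (continuous_neg.measurable.comp
      hmY.coe_real_ereal)).ereal_toENNReal).aemeasurable
  · filter_upwards [cond_absolutelyContinuous.ae_le hYS] with ω hω
    exact (coe_add_toENNReal_sub hω).symm

variable [IsProbabilityMeasure μ] [MeasurableSpace 𝒵] [MeasurableSingletonClass 𝒵]

/-- By reflexivity `z` competes in its own infimum, so `S - Y` leaves enough room on the fibre to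
fill the gap. -/
lemma gap_le_condLExp (hX : Measurable X) (hZ : Measurable Z) (hY : Integrable Y μ)
    (hS : Measurable S) (hmY : Measurable Y) (hYS : ∀ᵐ ω ∂μ, (Y ω : EReal) ≤ S ω)
    (hr : ∀ a, r a a) (z : 𝒵) :
    gap r μ X Z S Y z ≤ᵐ[ProbabilityTheory.cond μ (Z ⁻¹' {z})] condLExp (sigma X)
      (ProbabilityTheory.cond μ (Z ⁻¹' {z})) (fun ω => (S ω - Y ω).toENNReal) := by
  filter_upwards [eCondExp_cond_eq (X := X) hY hS hmY hYS z, ae_cond_probGiven_pos hX hZ z]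
    with ω h1 h2
  rw [← toENNReal_coe_add_sub (meanGiven μ X Z Y z ω)
    (condLExp (sigma X) _ (fun ω => (S ω - Y ω).toENNReal) ω), ← h1]
  exact EReal.toENNReal_le_toENNReal (EReal.sub_le_sub (iInf₂_le z ⟨hr z, h2⟩) le_rfl)

variable [Countable 𝒵]

/-- The gap is a truncated difference. Nothing is lost to truncation because the mean of `Y` at `z`
is below its mean at each admissible `z₂`, which is below that of `S`. -/
lemma upperEnv_eq_add_gap (hX : Measurable X) (hZ : Measurable Z) (hY : Integrable Y μ)
    (hS : Measurable S) (hmY : Measurable Y) (hYS : ∀ᵐ ω ∂μ, (Y ω : EReal) ≤ S ω)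
    (hmon : MonotoneAlong r μ X Z Y) :
    ∀ᵐ ω ∂μ, ∀ z, 0 < probGiven μ X Z z ω →
      (meanGiven μ X Z Y z ω : EReal) + (gap r μ X Z S Y z ω : EReal) =
        upperEnv r μ X Z S z ω := by
  have h1 : ∀ᵐ ω ∂μ, ∀ z, 0 < probGiven μ X Z z ω → (meanGiven μ X Z Y z ω : EReal) ≤
      eCondExp (ProbabilityTheory.cond μ (Z ⁻¹' {z})) (sigma X) S ω := by
    refine ae_all_iff.2 fun z => ?_
    have hset : MeasurableSet[sigma X] {ω | (meanGiven μ X Z Y z ω : EReal) ≤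
        eCondExp (ProbabilityTheory.cond μ (Z ⁻¹' {z})) (sigma X) S ω} :=
      measurableSet_le (measurable_meanGiven Y z).coe_real_ereal (measurable_eCondExp _ _)
    refine ae_of_ae_cond hX hZ hset ?_
    filter_upwards [eCondExp_cond_eq (X := X) hY hS hmY hYS z] with ω hω
    rw [hω]
    exact le_add_of_nonneg_right (EReal.coe_ennreal_nonneg _)
  have h2 : ∀ᵐ ω ∂μ, ∀ z z₂, r z z₂ → 0 < probGiven μ X Z z ω → 0 < probGiven μ X Z z₂ ω →
      meanGiven μ X Z Y z ω ≤ meanGiven μ X Z Y z₂ ω := by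
    simp_rw [ae_all_iff]
    exact hmon
  filter_upwards [h1, h2] with ω h1 h2 z hz
  refine coe_add_toENNReal_sub (le_iInf₂ fun z₂ h => ?_)
  exact (EReal.coe_le_coe_iff.2 (h2 z z₂ h.1 hz h.2)).trans (h1 z₂ h.2)

/-- A random variable below `S` with means monotone along `r` can be raised, on an event of `σ(X)`,
up to the envelope of `S` (or by at most `N`), if the total increase is integrable. -/
lemma exists_raise (hX : Measurable X) (hZ : Measurable Z) (hY : Integrable Y μ)
    (hS : Measurable S) (hmY : Measurable Y) (hYS : ∀ᵐ ω ∂μ, (Y ω : EReal) ≤ S ω)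
    (hrefl : ∀ a, r a a) (htrans : ∀ a b c, r a b → r b c → r a c)
    (hmon : MonotoneAlong r μ X Z Y) {A : Set Ω} (hA : MeasurableSet[sigma X] A) (N : ℝ≥0∞)
    (hfin : ∫⁻ ω in A, ∑' z, ENNReal.ofReal (probGiven μ X Z z ω) *
      min (gap r μ X Z S Y z ω) N ∂μ ≠ ⊤) :
    ∃ Y' : Ω → ℝ, Measurable Y' ∧ Integrable Y' μ ∧ (∀ ω, Y ω ≤ Y' ω) ∧
      (∀ᵐ ω ∂μ, (Y' ω : EReal) ≤ S ω) ∧ MonotoneAlong r μ X Z Y' ∧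
      ∫ ω in A, Y' ω ∂μ = ∫ ω in A, Y ω ∂μ + (∫⁻ ω in A, ∑' z,
        ENNReal.ofReal (probGiven μ X Z z ω) * min (gap r μ X Z S Y z ω) N ∂μ).toReal := by
  have hm : sigma X ≤ _ := hX.comap_le
  let h : 𝒵 → Ω → ℝ≥0∞ := fun z => A.indicator fun ω => min (gap r μ X Z S Y z ω) N
  have hh : ∀ z, Measurable[sigma X] (h z) := fun z =>
    ((measurable_gap z).min measurable_const).indicator hA
  have hD : Measurable fun ω => (S ω - Y ω).toENNReal := by
    simp_rw [sub_eq_add_neg]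
    exact (hS.add (continuous_neg.measurable.comp hmY.coe_real_ereal)).ereal_toENNReal
  have hex : ∀ z, ∃ G : Ω → ℝ≥0∞, Measurable G ∧ (∀ ω, G ω ≤ (S ω - Y ω).toENNReal) ∧
      condLExp (sigma X) (ProbabilityTheory.cond μ (Z ⁻¹' {z})) G
        =ᵐ[ProbabilityTheory.cond μ (Z ⁻¹' {z})] h z := by
    intro z
    refine exists_le_condLExp_eq hm hD (hh z) ?_
    filter_upwards [gap_le_condLExp hX hZ hY hS hmY hYS hrefl z] with ω hω
    refine le_trans ?_ hω
    by_cases hωA : ω ∈ A <;> simp [h, hωA]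
  choose G hGm hGD hGh using hex
  -- The fibrewise increments are glued along `Z`; measurability uses countability of the
  -- instrument.
  let g : Ω → ℝ≥0∞ := fun ω => G (Z ω) ω
  have hg : Measurable g := by
    have : Measurable fun p : Ω × 𝒵 => G p.2 p.1 := measurable_from_prod_countable_left hGm
    exact this.comp (measurable_id.prodMk hZ)
  have hgZ : ∀ z, ∀ᵐ ω ∂(ProbabilityTheory.cond μ (Z ⁻¹' {z})), g ω = G z ω := by
    intro z
    filter_upwards [ae_cond_mem (hZ (measurableSet_singleton z))] with ω hω
    have : Z ω = z := hω
    simp only [g, this]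
  have hlint : ∀ t, MeasurableSet[sigma X] t → ∫⁻ ω in t, g ω ∂μ =
      ∫⁻ ω in t, ∑' z, ENNReal.ofReal (probGiven μ X Z z ω) * h z ω ∂μ := by
    intro t ht
    have hpm : ∀ z, Measurable fun ω => ENNReal.ofReal (probGiven μ X Z z ω) :=
      fun z => ((measurable_probGiven z).mono hm le_rfl).ennreal_ofReal
    have hphm : ∀ z, Measurable fun ω => ENNReal.ofReal (probGiven μ X Z z ω) * h z ω :=
      fun z => (hpm z).mul ((hh z).mono hm le_rfl)
    rw [lintegral_tsum fun z => (hphm z).aemeasurable,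
      ← lintegral_indicator (hm t ht), lintegral_eq_tsum_lintegral_preimage hZ]
    refine tsum_congr fun z => ?_
    have e1 : ∫⁻ ω in t, ENNReal.ofReal (probGiven μ X Z z ω) * h z ω ∂μ =
        ∫⁻ ω, ENNReal.ofReal (probGiven μ X Z z ω) * t.indicator (h z) ω ∂μ := by
      rw [← lintegral_indicator (hm t ht)]
      refine lintegral_congr fun ω => ?_
      by_cases hω : ω ∈ t <;> simp [hω]
    rw [e1, lintegral_probGiven_mul hX hZ z ((hh z).indicator ht),
      lintegral_restrict_eq_mul_lintegral_cond, lintegral_restrict_eq_mul_lintegral_cond,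
      lintegral_indicator (hm t ht), lintegral_indicator (hm t ht),
      ← lintegral_congr_ae (ae_restrict_of_ae (hGh z)), setLIntegral_condLExp hm _ _ ht,
      lintegral_congr_ae (ae_restrict_of_ae (hgZ z))]
  have hhA : ∫⁻ ω, ∑' z, ENNReal.ofReal (probGiven μ X Z z ω) * h z ω ∂μ =
      ∫⁻ ω in A, ∑' z, ENNReal.ofReal (probGiven μ X Z z ω) *
        min (gap r μ X Z S Y z ω) N ∂μ := by
    rw [← lintegral_indicator (hm A hA)]
    refine lintegral_congr fun ω => ?_
    by_cases hω : ω ∈ A <;> simp [h, hω]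
  have hgfin : ∫⁻ ω, g ω ∂μ ≠ ⊤ := by
    have := hlint Set.univ MeasurableSet.univ
    rw [setLIntegral_univ, setLIntegral_univ, hhA] at this
    rwa [this]
  have hgi : Integrable (fun ω => (g ω).toReal) μ :=
    integrable_toReal_of_lintegral_ne_top hg.aemeasurable hgfin
  have hgtop : ∀ᵐ ω ∂μ, g ω < ⊤ := ae_lt_top hg hgfin
  have hhtop : ∀ᵐ ω ∂μ, ∀ z, 0 < probGiven μ X Z z ω → h z ω ≠ ⊤ := by
    rw [← hhA] at hfin
    have hmeas : Measurable fun ω => ∑' z, ENNReal.ofReal (probGiven μ X Z z ω) * h z ω :=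
      Measurable.tsum fun z => (((measurable_probGiven z).mono hm le_rfl).ennreal_ofReal).mul
        ((hh z).mono hm le_rfl)
    filter_upwards [ae_lt_top hmeas hfin] with ω hω z hz htop
    have := ENNReal.ne_top_of_tsum_ne_top hω.ne z
    rw [htop, ENNReal.mul_top (by simpa using hz)] at this
    exact this rfl
  have hmean : ∀ᵐ ω ∂μ, ∀ z, 0 < probGiven μ X Z z ω →
      meanGiven μ X Z (fun ω => Y ω + (g ω).toReal) z ω =
        meanGiven μ X Z Y z ω + (h z ω).toReal := by
    refine ae_all_iff.2 fun z => ?_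
    have hset : MeasurableSet[sigma X] {ω | meanGiven μ X Z (fun ω => Y ω + (g ω).toReal) z ω =
        meanGiven μ X Z Y z ω + (h z ω).toReal} :=
      measurableSet_eq_fun (measurable_meanGiven _ z)
        ((measurable_meanGiven Y z).add (hh z).ennreal_toReal)
    refine ae_of_ae_cond hX hZ hset ?_
    have hgc : ∫⁻ ω, g ω ∂(ProbabilityTheory.cond μ (Z ⁻¹' {z})) ≠ ⊤ := by
      rcases eq_or_ne (μ (Z ⁻¹' {z})) 0 with h0 | h0
      · simp [cond_eq_zero_of_meas_eq_zero h0]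
      · intro htop
        have := lintegral_restrict_eq_mul_lintegral_cond (μ := μ) (Z ⁻¹' {z}) g
        rw [htop, ENNReal.mul_top h0] at this
        exact ne_top_of_le_ne_top hgfin (setLIntegral_le_lintegral _ _) this
    filter_upwards [condExp_add (integrable_cond hY (Z ⁻¹' {z}))
      (integrable_cond hgi (Z ⁻¹' {z})) (sigma X), toReal_condLExp (sigma X) hg.aemeasurable hgc,
      hGh z, condLExp_congr_ae (mΩ := sigma X) (hgZ z)] with ω h1 h2 h3 h4
    refine h1.trans ?_
    rw [Pi.add_apply, ← h2, h4, h3]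
    rfl
  refine ⟨fun ω => Y ω + (g ω).toReal, hmY.add hg.ennreal_toReal, hY.add hgi,
    fun ω => le_add_of_nonneg_right ENNReal.toReal_nonneg, ?_, ?_, ?_⟩
  · filter_upwards [hgtop, hYS] with ω h1 h2
    rw [EReal.coe_add, coe_toReal_ennreal h1.ne]
    calc (Y ω : EReal) + (g ω : EReal) ≤ (Y ω : EReal) + ((S ω - Y ω).toENNReal : EReal) :=
          add_le_add_right (EReal.coe_ennreal_le_coe_ennreal_iff.2 (hGD (Z ω) ω)) _
      _ = S ω := coe_add_toENNReal_sub h2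
  · intro z z₂ hzz
    filter_upwards [hmean, hhtop, hmon z z₂ hzz,
      upperEnv_eq_add_gap hX hZ hY hS hmY hYS hmon] with ω h1 h2 h3 h4 hz hz₂
    rw [h1 z hz, h1 z₂ hz₂]
    by_cases hωA : ω ∈ A
    · rw [← EReal.coe_le_coe_iff, EReal.coe_add, EReal.coe_add, coe_toReal_ennreal (h2 z hz),
        coe_toReal_ennreal (h2 z₂ hz₂)]
      have e : ∀ z, h z ω = min (gap r μ X Z S Y z ω) N := fun z => by simp [h, hωA]
      rw [e, e]
      -- The new mean is the minimum of the envelope and the old mean plus `N`, both monotone; the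
      -- cases say which one is active at `z₂`.
      rcases le_total (gap r μ X Z S Y z₂ ω) N with hN | hN
      · rw [min_eq_left hN, h4 z₂ hz₂]
        calc _ ≤ (meanGiven μ X Z Y z ω : EReal) + (gap r μ X Z S Y z ω : EReal) :=
              add_le_add_right (EReal.coe_ennreal_le_coe_ennreal_iff.2 (min_le_left _ _)) _
          _ = upperEnv r μ X Z S z ω := h4 z hz
          _ ≤ _ := upperEnv_mono htrans hzz ω
      · rw [min_eq_right hN]
        exact add_le_add (EReal.coe_le_coe_iff.2 (h3 hz hz₂))
          (EReal.coe_ennreal_le_coe_ennreal_iff.2 (min_le_right _ _))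
    · have e : ∀ z, h z ω = 0 := fun z => by simp [h, hωA]
      rw [e, e]
      simpa using h3 hz hz₂
  · rw [integral_add hY.integrableOn hgi.integrableOn,
      integral_toReal hg.aemeasurable (ae_restrict_of_ae hgtop), hlint A hA]
    congr 2
    refine setLIntegral_congr_fun (hm A hA) fun ω hω => ?_
    simp [h, hω]

end Envelope

/-! ### Support functions of random sets in the plane -/

lemma measurable_supportFun {Ω : Type*} [MeasurableSpace Ω] {K : Ω → Set (ℝ × ℝ)}
    (hK : IsRandomClosedSet K) (v : ℝ × ℝ) : Measurable fun ω => supportFun v (K ω) := by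
  refine measurable_of_Ioi fun a => ?_
  -- The support function exceeds `a` exactly when `K` meets a compact piece of a half-plane at some
  -- rational level above `a`.
  have hset : (fun ω => supportFun v (K ω)) ⁻¹' Set.Ioi a =
      ⋃ (q : ℚ) (_ : a < ((q : ℝ) : EReal)) (n : ℕ), {ω | (K ω ∩
        (Metric.closedBall 0 n ∩ {y | (q : ℝ) ≤ v.1 * y.1 + v.2 * y.2})).Nonempty} := by
    ext ω
    simp only [Set.mem_preimage, Set.mem_Ioi, supportFun, lt_iSup_iff, Set.mem_iUnion,
      Set.mem_ofPred_eq]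
    constructor
    · rintro ⟨y, hy, hlt⟩
      obtain ⟨q, hq1, hq2⟩ := EReal.lt_iff_exists_rat_btwn.1 hlt
      obtain ⟨n, hn⟩ := exists_nat_ge ‖y‖
      exact ⟨q, hq1, n, y, hy, by simpa using hn, (EReal.coe_lt_coe_iff.1 hq2).le⟩
    · rintro ⟨q, hq, n, y, hy, -, hqy⟩
      exact ⟨y, hy, hq.trans_le (EReal.coe_le_coe_iff.2 hqy)⟩
  rw [hset]
  refine MeasurableSet.iUnion fun q => MeasurableSet.iUnion fun _ => MeasurableSet.iUnion fun n =>
    hK.2 _ ((isCompact_closedBall _ _).inter_right (isClosed_le continuous_const ?_))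
  fun_prop

/-- A closed convex subset of the line is a closed interval, so it contains every real number
between a member and its supremum. This keeps raised outcomes inside the random set. -/
lemma mem_of_forall_lt_exists_mem {C : Set ℝ} (hconv : Convex ℝ C) (hC : IsClosed C) {y t : ℝ}
    (hy : y ∈ C) (hyt : y ≤ t) (h : ∀ a < t, ∃ c ∈ C, a < c) : t ∈ C := by
  by_cases hex : ∃ c ∈ C, t ≤ c
  · obtain ⟨c, hc, htc⟩ := hex
    exact hconv.ordConnected.out hy hc ⟨hyt, htc⟩
  · push Not at hex
    rw [← hC.closure_eq, Metric.mem_closure_iff]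
    intro ε hε
    obtain ⟨c, hc, hlt⟩ := h (t - ε) (by linarith)
    refine ⟨c, hc, ?_⟩
    rw [Real.dist_eq, abs_of_pos (by linarith [hex c hc])]
    linarith

/-! ### Closed convex rectangles and their support functions. -/

section Rectangle

variable {A B : Set ℝ}

lemma isClosed_fst_of_prod (h : IsClosed (A ×ˢ B)) (hB : B.Nonempty) : IsClosed A := by
  obtain ⟨b, hb⟩ := hB
  have : A = (fun a => (a, b)) ⁻¹' (A ×ˢ B) := by ext a; simp [hb]
  rw [this]
  exact h.preimage (by fun_prop)

lemma isClosed_snd_of_prod (h : IsClosed (A ×ˢ B)) (hA : A.Nonempty) : IsClosed B := by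
  obtain ⟨a, ha⟩ := hA
  have : B = (fun b => (a, b)) ⁻¹' (A ×ˢ B) := by ext a; simp [ha]
  rw [this]
  exact h.preimage (by fun_prop)

lemma convex_fst_of_prod (h : Convex ℝ (A ×ˢ B)) (hB : B.Nonempty) : Convex ℝ A := by
  have := h.linear_image (LinearMap.fst ℝ ℝ ℝ)
  rwa [LinearMap.coe_fst, Set.fst_image_prod _ hB] at this

lemma convex_snd_of_prod (h : Convex ℝ (A ×ˢ B)) (hA : A.Nonempty) : Convex ℝ B := by
  have := h.linear_image (LinearMap.snd ℝ ℝ ℝ)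
  rwa [LinearMap.coe_snd, Set.snd_image_prod hA] at this

lemma coe_le_supportFun {K : Set (ℝ × ℝ)} {y : ℝ × ℝ} (hy : y ∈ K) (v : ℝ × ℝ) :
    ((v.1 * y.1 + v.2 * y.2 : ℝ) : EReal) ≤ supportFun v K :=
  le_iSup₂ (f := fun y (_ : y ∈ K) => ((v.1 * y.1 + v.2 * y.2 : ℝ) : EReal)) y hy

lemma exists_mem_of_lt_of_le_supportFun {K : Set (ℝ × ℝ)} {v : ℝ × ℝ} {a t : ℝ} (hat : a < t)
    (ht : (t : EReal) ≤ supportFun v K) : ∃ y ∈ K, a < v.1 * y.1 + v.2 * y.2 := by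
  have h := (EReal.coe_lt_coe_iff.2 hat).trans_le ht
  simp only [supportFun, lt_iSup_iff] at h
  obtain ⟨y, hy, hlt⟩ := h
  exact ⟨y, hy, EReal.coe_lt_coe_iff.1 hlt⟩

lemma fst_mem_of_le_supportFun (hconv : Convex ℝ A) (hA : IsClosed A) {y t : ℝ} (hy : y ∈ A)
    (hyt : y ≤ t) (ht : (t : EReal) ≤ supportFun (1, 0) (A ×ˢ B)) : t ∈ A := by
  refine mem_of_forall_lt_exists_mem hconv hA hy hyt fun a hat => ?_
  obtain ⟨c, hc, hlt⟩ := exists_mem_of_lt_of_le_supportFun hat ht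
  exact ⟨c.1, hc.1, by simpa using hlt⟩

lemma snd_mem_of_le_supportFun (hconv : Convex ℝ B) (hB : IsClosed B) {y t : ℝ} (hy : y ∈ B)
    (hyt : y ≤ t) (ht : (t : EReal) ≤ supportFun (0, 1) (A ×ˢ B)) : t ∈ B := by
  refine mem_of_forall_lt_exists_mem hconv hB hy hyt fun a hat => ?_
  obtain ⟨c, hc, hlt⟩ := exists_mem_of_lt_of_le_supportFun hat ht
  exact ⟨c.2, hc.2, by simpa using hlt⟩

lemma neg_fst_mem_of_le_supportFun (hconv : Convex ℝ A) (hA : IsClosed A) {y t : ℝ} (hy : y ∈ A)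
    (hyt : -y ≤ t) (ht : (t : EReal) ≤ supportFun (-(1, 0)) (A ×ˢ B)) : -t ∈ A := by
  refine mem_of_forall_lt_exists_mem (C := -A) hconv.neg hA.neg (y := -y) (by simpa using hy)
    hyt fun a hat => ?_
  obtain ⟨c, hc, hlt⟩ := exists_mem_of_lt_of_le_supportFun hat ht
  exact ⟨-c.1, by simpa using hc.1, by simpa using hlt⟩

lemma neg_snd_mem_of_le_supportFun (hconv : Convex ℝ B) (hB : IsClosed B) {y t : ℝ} (hy : y ∈ B)
    (hyt : -y ≤ t) (ht : (t : EReal) ≤ supportFun (-(0, 1)) (A ×ˢ B)) : -t ∈ B := by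
  refine mem_of_forall_lt_exists_mem (C := -B) hconv.neg hB.neg (y := -y) (by simpa using hy)
    hyt fun a hat => ?_
  obtain ⟨c, hc, hlt⟩ := exists_mem_of_lt_of_le_supportFun hat ht
  exact ⟨-c.2, by simpa using hc.2, by simpa using hlt⟩

end Rectangle

/-! ### Linearity and monotonicity of `E[Y | X, Z = z]` -/

section Means

variable {Ω 𝒳 𝒵 : Type*} [MeasurableSpace Ω] [MeasurableSpace 𝒳] {μ : Measure Ω}
  [IsProbabilityMeasure μ] [MeasurableSpace 𝒵] [MeasurableSingletonClass 𝒵] {X : Ω → 𝒳}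
  {Z : Ω → 𝒵}

lemma meanGiven_ae_eq (hX : Measurable X) (hZ : Measurable Z) {V : Ω → ℝ} {z : 𝒵} {g : Ω → ℝ}
    (hg : Measurable[sigma X] g)
    (h : meanGiven μ X Z V z =ᵐ[ProbabilityTheory.cond μ (Z ⁻¹' {z})] g) :
    ∀ᵐ ω ∂μ, 0 < probGiven μ X Z z ω → meanGiven μ X Z V z ω = g ω := by
  have hset : MeasurableSet[sigma X] {ω | meanGiven μ X Z V z ω = g ω} :=
    measurableSet_eq_fun (measurable_meanGiven V z) hg
  exact ae_of_ae_cond hX hZ hset h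

variable {Y W : Ω → ℝ}

lemma meanGiven_add (hX : Measurable X) (hZ : Measurable Z) (hY : Integrable Y μ)
    (hW : Integrable W μ) (z : 𝒵) :
    ∀ᵐ ω ∂μ, 0 < probGiven μ X Z z ω → meanGiven μ X Z (fun ω => Y ω + W ω) z ω =
      meanGiven μ X Z Y z ω + meanGiven μ X Z W z ω :=
  meanGiven_ae_eq hX hZ ((measurable_meanGiven Y z).add (measurable_meanGiven W z))
    (condExp_add (integrable_cond hY _) (integrable_cond hW _) _)

lemma meanGiven_neg (hX : Measurable X) (hZ : Measurable Z) (Y : Ω → ℝ) (z : 𝒵) :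
    ∀ᵐ ω ∂μ, 0 < probGiven μ X Z z ω → meanGiven μ X Z (fun ω => -Y ω) z ω =
      -meanGiven μ X Z Y z ω :=
  meanGiven_ae_eq hX hZ (measurable_meanGiven Y z).neg (condExp_neg _ _)

lemma meanGiven_const_mul (hX : Measurable X) (hZ : Measurable Z) (c : ℝ) (Y : Ω → ℝ) (z : 𝒵) :
    ∀ᵐ ω ∂μ, 0 < probGiven μ X Z z ω → meanGiven μ X Z (fun ω => c * Y ω) z ω =
      c * meanGiven μ X Z Y z ω :=
  meanGiven_ae_eq hX hZ ((measurable_meanGiven Y z).const_mul c) (condExp_smul c Y _)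

lemma meanGiven_indicator (hX : Measurable X) (hZ : Measurable Z) (hY : Integrable Y μ)
    {A : Set Ω} (hA : MeasurableSet[sigma X] A) (z : 𝒵) :
    ∀ᵐ ω ∂μ, 0 < probGiven μ X Z z ω → meanGiven μ X Z (A.indicator Y) z ω =
      A.indicator (meanGiven μ X Z Y z) ω :=
  meanGiven_ae_eq hX hZ ((measurable_meanGiven Y z).indicator hA)
    (condExp_indicator (integrable_cond hY _) hA)

variable {r : 𝒵 → 𝒵 → Prop}

/-- Reduces lower bounds on `Y` to upper bounds on `-Y`. -/
lemma MonotoneAlong.neg (hX : Measurable X) (hZ : Measurable Z) (h : MonotoneAlong r μ X Z Y) :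
    MonotoneAlong (fun a b => r b a) μ X Z (fun ω => -Y ω) := by
  intro z z₂ hz
  filter_upwards [h z₂ z hz, meanGiven_neg (μ := μ) hX hZ Y z, meanGiven_neg (μ := μ) hX hZ Y z₂]
    with ω h1 h2 h3 hp hp₂
  rw [h2 hp, h3 hp₂]
  exact neg_le_neg (h1 hp₂ hp)

/-- Indicators of events in `σ(X)` factor out of `E[· | X, Z = z]`, so outcomes may be modified
differently on such an event and on its complement. -/
lemma MonotoneAlong.indicator_add (hX : Measurable X) (hZ : Measurable Z) (hY : Integrable Y μ)
    (hW : Integrable W μ) (hYm : MonotoneAlong r μ X Z Y) (hWm : MonotoneAlong r μ X Z W)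
    {A : Set Ω} (hA : MeasurableSet[sigma X] A) :
    MonotoneAlong r μ X Z (fun ω => A.indicator Y ω + Aᶜ.indicator W ω) := by
  have hm : sigma X ≤ _ := hX.comap_le
  intro z z₂ hz
  have key : ∀ z, ∀ᵐ ω ∂μ, 0 < probGiven μ X Z z ω →
      meanGiven μ X Z (fun ω => A.indicator Y ω + Aᶜ.indicator W ω) z ω =
        A.indicator (meanGiven μ X Z Y z) ω + Aᶜ.indicator (meanGiven μ X Z W z) ω := by
    intro z
    filter_upwards [meanGiven_add hX hZ (hY.indicator (hm _ hA)) (hW.indicator (hm _ hA.compl)) z,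
      meanGiven_indicator hX hZ hY hA z, meanGiven_indicator hX hZ hW hA.compl z]
      with ω h1 h2 h3 hp
    rw [h1 hp, h2 hp, h3 hp]
  filter_upwards [key z, key z₂, hYm z z₂ hz, hWm z z₂ hz] with ω h1 h2 h3 h4 hp hp₂
  rw [h1 hp, h2 hp₂]
  by_cases hω : ω ∈ A
  · simpa [hω] using h3 hp hp₂
  · simpa [hω] using h4 hp hp₂

lemma MonotoneAlong.convex_comb (hX : Measurable X) (hZ : Measurable Z) (hY : Integrable Y μ)
    (hW : Integrable W μ) (hYm : MonotoneAlong r μ X Z Y) (hWm : MonotoneAlong r μ X Z W)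
    {a b : ℝ} (ha : 0 ≤ a) (hb : 0 ≤ b) :
    MonotoneAlong r μ X Z (fun ω => a * Y ω + b * W ω) := by
  intro z z₂ hz
  have key : ∀ z, ∀ᵐ ω ∂μ, 0 < probGiven μ X Z z ω →
      meanGiven μ X Z (fun ω => a * Y ω + b * W ω) z ω =
        a * meanGiven μ X Z Y z ω + b * meanGiven μ X Z W z ω := by
    intro z
    filter_upwards [meanGiven_add hX hZ (hY.const_mul a) (hW.const_mul b) z,
      meanGiven_const_mul (μ := μ) hX hZ a Y z, meanGiven_const_mul (μ := μ) hX hZ b W z]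
      with ω h1 h2 h3 hp
    rw [h1 hp, h2 hp, h3 hp]
  filter_upwards [key z, key z₂, hYm z z₂ hz, hWm z z₂ hz] with ω h1 h2 h3 h4 hp hp₂
  rw [h1 hp, h2 hp₂]
  have := h3 hp hp₂
  have := h4 hp hp₂
  gcongr

end Means

/-! ### Weighted sums of envelopes -/

section Sums

variable {Ω 𝒳 𝒵 : Type*} [MeasurableSpace Ω] [MeasurableSpace 𝒳] {μ : Measure Ω}
  [IsProbabilityMeasure μ] [MeasurableSpace 𝒵] [MeasurableSingletonClass 𝒵] [Countable 𝒵]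
  {X : Ω → 𝒳} {Z : Ω → 𝒵} {r r' : 𝒵 → 𝒵 → Prop} {S S' : Ω → EReal} {Y Y' : Ω → ℝ}

/-- The hypotheses under which the means of `Y` lie below the envelope of `S` along `r`. -/
structure IsMonotoneMinorant (r : 𝒵 → 𝒵 → Prop) (μ : Measure Ω) (X : Ω → 𝒳) (Z : Ω → 𝒵)
    (S : Ω → EReal) (Y : Ω → ℝ) : Prop where
  measurable_majorant : Measurable S
  measurable : Measurable Y
  integrable : Integrable Y μ
  le : ∀ᵐ ω ∂μ, (Y ω : EReal) ≤ S ω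
  mono : MonotoneAlong r μ X Z Y

lemma probGiven_mul_upperEnv_add (hX : Measurable X) (hZ : Measurable Z)
    (h : IsMonotoneMinorant r μ X Z S Y) (h' : IsMonotoneMinorant r' μ X Z S' Y') :
    ∀ᵐ ω ∂μ, ∀ z,
      (probGiven μ X Z z ω : EReal) *
          (upperEnv r μ X Z S z ω + upperEnv r' μ X Z S' z ω) =
        ((probGiven μ X Z z ω * meanGiven μ X Z (fun ω => Y ω + Y' ω) z ω : ℝ) : EReal) +
          ((ENNReal.ofReal (probGiven μ X Z z ω) *
            (gap r μ X Z S Y z ω + gap r' μ X Z S' Y' z ω) : ℝ≥0∞) : EReal) ∧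
      (probGiven μ X Z z ω : EReal) *
          (-upperEnv r μ X Z S z ω - upperEnv r' μ X Z S' z ω) =
        -(((probGiven μ X Z z ω * meanGiven μ X Z (fun ω => Y ω + Y' ω) z ω : ℝ) : EReal) +
          ((ENNReal.ofReal (probGiven μ X Z z ω) *
            (gap r μ X Z S Y z ω + gap r' μ X Z S' Y' z ω) : ℝ≥0∞) : EReal)) := by
  have hadd : ∀ᵐ ω ∂μ, ∀ z, 0 < probGiven μ X Z z ω →
      meanGiven μ X Z (fun ω => Y ω + Y' ω) z ω =
      meanGiven μ X Z Y z ω + meanGiven μ X Z Y' z ω :=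
    ae_all_iff.2 fun z => meanGiven_add hX hZ h.integrable h'.integrable z
  filter_upwards [hadd, probGiven_nonneg (μ := μ) (X := X) (Z := Z),
    upperEnv_eq_add_gap hX hZ h.integrable h.measurable_majorant h.measurable h.le h.mono,
    upperEnv_eq_add_gap hX hZ h'.integrable h'.measurable_majorant h'.measurable h'.le h'.mono]
    with ω h1 h2 h3 h4 z
  -- Where `P(Z = z | X)` vanishes nothing is known about means or envelopes, but the zero weight
  -- removes both sides.
  rcases (h2 z).eq_or_lt with h0 | hpos
  · simp [← h0]
  have e : (probGiven μ X Z z ω : EReal) *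
      (upperEnv r μ X Z S z ω + upperEnv r' μ X Z S' z ω) =
      ((probGiven μ X Z z ω * meanGiven μ X Z (fun ω => Y ω + Y' ω) z ω : ℝ) : EReal) +
        ((ENNReal.ofReal (probGiven μ X Z z ω) *
          (gap r μ X Z S Y z ω + gap r' μ X Z S' Y' z ω) : ℝ≥0∞) : EReal) := by
    rw [← h3 z hpos, ← h4 z hpos, add_add_add_comm, ← EReal.coe_add, ← h1 z hpos,
      EReal.left_distrib_of_nonneg_of_ne_top (EReal.coe_nonneg.2 (h2 z)) (EReal.coe_ne_top _),
      EReal.coe_ennreal_mul, EReal.coe_ennreal_add, EReal.coe_ennreal_ofReal, max_eq_left (h2 z),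
      EReal.coe_mul]
  -- Neither envelope is `⊥`, so negation distributes over their sum.
  have hbot : ∀ {r : 𝒵 → 𝒵 → Prop} {S : Ω → EReal} {Y : Ω → ℝ},
      (meanGiven μ X Z Y z ω : EReal) + (gap r μ X Z S Y z ω : EReal) = upperEnv r μ X Z S z ω →
      upperEnv r μ X Z S z ω ≠ ⊥ := by
    intro r S Y he
    rw [← he]
    simp [EReal.add_eq_bot_iff]
  refine ⟨e, ?_⟩
  rw [← e, ← mul_neg, EReal.neg_add (.inl (hbot (h3 z hpos))) (.inr (hbot (h4 z hpos)))]

lemma eSum_probGiven_mul_upperEnv_add (hX : Measurable X) (hZ : Measurable Z)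
    (h : IsMonotoneMinorant r μ X Z S Y) (h' : IsMonotoneMinorant r' μ X Z S' Y') :
    ∀ᵐ ω ∂μ,
      eSum (fun z => (probGiven μ X Z z ω : EReal) *
          (upperEnv r μ X Z S z ω + upperEnv r' μ X Z S' z ω)) =
        (((μ[fun ω => Y ω + Y' ω | sigma X]) ω : ℝ) : EReal) +
          ((∑' z, ENNReal.ofReal (probGiven μ X Z z ω) *
            (gap r μ X Z S Y z ω + gap r' μ X Z S' Y' z ω) : ℝ≥0∞) : EReal) ∧
      eSum (fun z => (probGiven μ X Z z ω : EReal) *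
          (-upperEnv r μ X Z S z ω - upperEnv r' μ X Z S' z ω)) =
        -((((μ[fun ω => Y ω + Y' ω | sigma X]) ω : ℝ) : EReal) +
          ((∑' z, ENNReal.ofReal (probGiven μ X Z z ω) *
            (gap r μ X Z S Y z ω + gap r' μ X Z S' Y' z ω) : ℝ≥0∞) : EReal)) := by
  filter_upwards [probGiven_mul_upperEnv_add hX hZ h h',
    hasSum_probGiven_mul_meanGiven hX hZ (h.integrable.add h'.integrable)] with ω h1 h2
  have h2' : HasSum (fun z => probGiven μ X Z z ω * meanGiven μ X Z (fun ω => Y ω + Y' ω) z ω)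
    ((μ[fun ω => Y ω + Y' ω | sigma X]) ω) := h2
  constructor
  · simp_rw [fun z => (h1 z).1]
    rw [eSum_add_coe h2'.summable, h2'.tsum_eq]
  · simp_rw [fun z => (h1 z).2]
    rw [eSum_neg_add_coe h2'.summable, h2'.tsum_eq]

end Sums

/-! ### Expected slack and its truncations. -/

section Slack

variable {Ω 𝒳 𝒵 : Type*} [MeasurableSpace Ω] [MeasurableSpace 𝒳] {μ : Measure Ω}
  {X : Ω → 𝒳} {Z : Ω → 𝒵} {r : 𝒵 → 𝒵 → Prop} {S : Ω → EReal} {Y : Ω → ℝ}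

/-- The expected increase, over the event `A`, when the means of `Y` are raised to the envelope
of `S` or by at most `N`. -/
noncomputable def slack (r : 𝒵 → 𝒵 → Prop) (μ : Measure Ω) (X : Ω → 𝒳) (Z : Ω → 𝒵)
    (S : Ω → EReal) (Y : Ω → ℝ) (A : Set Ω) (N : ℝ≥0∞) : ℝ≥0∞ :=
  ∫⁻ ω in A, ∑' z, ENNReal.ofReal (probGiven μ X Z z ω) * min (gap r μ X Z S Y z ω) N ∂μ

variable [Countable 𝒵]

lemma measurable_ofReal_probGiven_mul_gap (hX : Measurable X) (z : 𝒵) (N : ℝ≥0∞) :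
    Measurable fun ω => ENNReal.ofReal (probGiven μ X Z z ω) * min (gap r μ X Z S Y z ω) N :=
  have h : Measurable[sigma X] fun ω =>
      ENNReal.ofReal (probGiven μ X Z z ω) * min (gap r μ X Z S Y z ω) N :=
    (measurable_probGiven z).ennreal_ofReal.mul ((measurable_gap z).min measurable_const)
  h.mono hX.comap_le le_rfl

lemma setLIntegral_tsum_gap_add {r' : 𝒵 → 𝒵 → Prop} {S' : Ω → EReal} {Y' : Ω → ℝ} (hX : Measurable X)
    (A : Set Ω) :
    ∫⁻ ω in A, ∑' z, ENNReal.ofReal (probGiven μ X Z z ω) *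
        (gap r μ X Z S Y z ω + gap r' μ X Z S' Y' z ω) ∂μ =
      slack r μ X Z S Y A ⊤ + slack r' μ X Z S' Y' A ⊤ := by
  unfold slack
  rw [← lintegral_add_left (Measurable.tsum fun z => measurable_ofReal_probGiven_mul_gap hX z ⊤)]
  refine lintegral_congr fun ω => ?_
  rw [← ENNReal.tsum_add]
  exact tsum_congr fun z => by rw [min_eq_left le_top, min_eq_left le_top, mul_add]

/-- Monotone convergence: an infinite slack has unbounded truncations. -/
lemma iSup_slack_natCast (hX : Measurable X) (A : Set Ω) :
    ⨆ n : ℕ, slack r μ X Z S Y A n = slack r μ X Z S Y A ⊤ := by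
  unfold slack
  rw [← lintegral_iSup]
  · refine lintegral_congr fun ω => ?_
    simp_rw [ENNReal.tsum_eq_iSup_sum]
    rw [iSup_comm]
    refine iSup_congr fun s => ?_
    have hmono : ∀ z, Monotone fun n : ℕ => ENNReal.ofReal (probGiven μ X Z z ω) *
        min (gap r μ X Z S Y z ω) n :=
      fun z a b hab => mul_le_mul_right (min_le_min le_rfl (Nat.cast_le.2 hab)) _
    rw [← ENNReal.finsetSum_iSup_of_monotone hmono]
    refine Finset.sum_congr rfl fun z _ => ?_
    rw [← ENNReal.mul_iSup, ← inf_iSup_eq, ENNReal.iSup_natCast]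
  · exact fun n => Measurable.tsum fun z => measurable_ofReal_probGiven_mul_gap hX z n
  · intro a b hab ω
    exact ENNReal.tsum_le_tsum fun z =>
      mul_le_mul_right (min_le_min le_rfl (Nat.cast_le.2 hab)) _

variable [IsProbabilityMeasure μ] [MeasurableSpace 𝒵] [MeasurableSingletonClass 𝒵]

/-- The weights integrate to total mass one, so an increase of at most `n` costs at most `n`. -/
lemma slack_natCast_ne_top (hX : Measurable X) (hZ : Measurable Z) (A : Set Ω) (n : ℕ) :
    slack r μ X Z S Y A n ≠ ⊤ := by
  refine ne_top_of_le_ne_top (ENNReal.natCast_ne_top n) ?_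
  calc slack r μ X Z S Y A n
      ≤ ∫⁻ ω, ∑' z, ENNReal.ofReal (probGiven μ X Z z ω) * (n : ℝ≥0∞) ∂μ :=
        (setLIntegral_le_lintegral _ _).trans (lintegral_mono fun ω =>
          ENNReal.tsum_le_tsum fun z => mul_le_mul_right (min_le_right _ _) _)
    _ = ∫⁻ _, (n : ℝ≥0∞) ∂μ := by
        rw [lintegral_eq_tsum_lintegral_preimage hZ fun _ => (n : ℝ≥0∞), lintegral_tsum]
        · exact tsum_congr fun z => lintegral_probGiven_mul hX hZ z measurable_const
        · exact fun z => (((measurable_probGiven z).mono hX.comap_le le_rfl).ennreal_ofReal.mul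
            measurable_const).aemeasurable
    _ = n := by simp

lemma IsMonotoneMinorant.exists_raise
    (h : IsMonotoneMinorant r μ X Z S Y) (hX : Measurable X) (hZ : Measurable Z)
    (hrefl : ∀ a, r a a) (htrans : ∀ a b c, r a b → r b c → r a c) {A : Set Ω}
    (hA : MeasurableSet[sigma X] A) {N : ℝ≥0∞} (hfin : slack r μ X Z S Y A N ≠ ⊤) :
    ∃ Y' : Ω → ℝ, Measurable Y' ∧ Integrable Y' μ ∧ (∀ ω, Y ω ≤ Y' ω) ∧
      (∀ᵐ ω ∂μ, (Y' ω : EReal) ≤ S ω) ∧ MonotoneAlong r μ X Z Y' ∧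
      ∫ ω in A, Y' ω ∂μ = ∫ ω in A, Y ω ∂μ + (slack r μ X Z S Y A N).toReal :=
  _root_.WelfareGain.exists_raise hX hZ h.integrable h.measurable_majorant h.measurable h.le hrefl htrans
    h.mono hA N hfin

end Slack

/-! ### Welfare gains and their bounds -/

section Gain

variable {Ω 𝒳 𝒵 : Type*} {X : Ω → 𝒳} {Z : Ω → 𝒵} {δ δ' : 𝒳 → Fin 2}

/-- The event that the rule `δ` treats and `δ'` does not. -/
def switchSet (X : Ω → 𝒳) (δ δ' : 𝒳 → Fin 2) : Set Ω := {ω | δ (X ω) = 1 ∧ δ' (X ω) = 0}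

lemma disjoint_switchSet : Disjoint (switchSet X δ δ') (switchSet X δ' δ) :=
  Set.disjoint_left.2 fun ω h h' => by simpa [h.1] using h'.2

lemma switch_of_mem {ω : Ω} (h : ω ∈ switchSet X δ δ') : switch δ δ' (X ω) = 1 :=
  if_pos h

lemma switch_of_notMem {ω : Ω} (h : ω ∉ switchSet X δ δ') : switch δ δ' (X ω) = 0 :=
  if_neg h

lemma coe_sub_coe_eq_indicator (ω : Ω) :
    (((δ (X ω) : ℕ) : ℝ) - ((δ' (X ω) : ℕ) : ℝ)) =
      (switchSet X δ δ').indicator 1 ω - (switchSet X δ' δ).indicator 1 ω := by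
  have key : ∀ a b : Fin 2, (((a : ℕ) : ℝ) - ((b : ℕ) : ℝ)) =
      (if a = 1 ∧ b = 0 then 1 else 0) - (if b = 1 ∧ a = 0 then 1 else 0) := by
    intro a b
    fin_cases a <;> fin_cases b <;> simp
  rw [key]
  simp only [Set.indicator, switchSet, Set.mem_ofPred_eq, Pi.one_apply]
  congr

lemma gainBound_congr [MeasurableSpace Ω] {μ : Measure Ω} {f g f' g' : Ω → EReal} (hf : f =ᵐ[μ] f') (hg : g =ᵐ[μ] g') :
    gainBound μ X δ δ' f g = gainBound μ X δ δ' f' g' := by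
  unfold gainBound eExp
  congr 2
  all_goals
    refine lintegral_congr_ae ?_
    filter_upwards [hf, hg] with ω h1 h2
    rw [h1, h2]

variable [MeasurableSpace 𝒳]

lemma measurableSet_switchSet (hδ : Measurable δ) (hδ' : Measurable δ') :
    MeasurableSet[sigma X] (switchSet X δ δ') :=
  ⟨{x | δ x = 1 ∧ δ' x = 0},
    (hδ (measurableSet_singleton 1)).inter (hδ' (measurableSet_singleton 0)), rfl⟩

variable [MeasurableSpace Ω] {μ : Measure Ω}

/-- The rules differ on two events of `σ(X)`, over which a conditional expectation integrates like
the variable itself. -/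
lemma welfareGain_eq [IsProbabilityMeasure μ] (hX : Measurable X) (hδ : Measurable δ)
    (hδ' : Measurable δ') {Y₁ Y₀ : Ω → ℝ} (h₁ : Integrable Y₁ μ) (h₀ : Integrable Y₀ μ) :
    welfareGain μ X δ δ' Y₁ Y₀ =
      (∫ ω in switchSet X δ δ', (Y₁ ω - Y₀ ω) ∂μ) -
        ∫ ω in switchSet X δ' δ, (Y₁ ω - Y₀ ω) ∂μ := by
  have hm : sigma X ≤ _ := hX.comap_le
  have hA : MeasurableSet[sigma X] (switchSet X δ δ') := measurableSet_switchSet hδ hδ'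
  have hB : MeasurableSet[sigma X] (switchSet X δ' δ) := measurableSet_switchSet hδ' hδ
  have hi : Integrable (fun ω => Y₁ ω - Y₀ ω) μ := h₁.sub h₀
  rw [← setIntegral_condExp hm hi hA, ← setIntegral_condExp hm hi hB,
    ← integral_indicator (hm _ hA), ← integral_indicator (hm _ hB),
    ← integral_sub (integrable_condExp.indicator (hm _ hA))
      (integrable_condExp.indicator (hm _ hB))]
  refine integral_congr_ae (Eventually.of_forall fun ω => ?_)
  simp only [coe_sub_coe_eq_indicator]
  by_cases ha : ω ∈ switchSet X δ δ' <;> by_cases hb : ω ∈ switchSet X δ' δ <;> simp [ha, hb]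

lemma supLower_eq_neg_upperEnv [LE 𝒵] (K : Ω → Set (ℝ × ℝ)) (v : ℝ × ℝ) (z : 𝒵) (ω : Ω) :
    supLower μ X Z K v z ω =
      -upperEnv (fun a b => b ≤ a) μ X Z (fun ω => supportFun (-v) (K ω)) z ω := by
  refine le_antisymm (iSup₂_le fun z₁ h => ?_) ?_
  · exact EReal.neg_le_neg_iff.2 (iInf₂_le z₁ h)
  · rw [EReal.neg_le]
    refine le_iInf₂ fun z₁ h => ?_
    rw [EReal.neg_le]
    exact le_iSup₂ (f := fun z₁ (_ : z₁ ∈ {z₁ : 𝒵 | z₁ ≤ z ∧ 0 < probGiven μ X Z z₁ ω}) =>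
      -suppGiven μ X Z K (-v) z₁ ω) z₁ h

/-! ### MIV selections and the slack of their welfare gain. -/

section Selection

variable [PartialOrder 𝒵] {K : Ω → Set (ℝ × ℝ)} {Y₁ Y₀ W₁ W₀ : Ω → ℝ}

lemma meanMonotone_iff : MeanMonotone μ X Z Y₁ ↔ MonotoneAlong (· ≤ ·) μ X Z Y₁ := by
  constructor
  · intro h z z₂ hz
    filter_upwards [h z₂ z hz] with ω h1 h2 h3 using h1 h3 h2
  · intro h z z₂ hz
    filter_upwards [h z₂ z hz] with ω h1 h2 h3 using h1 h3 h2

lemma IsMIVSelection.measurable_fst (h : IsMIVSelection μ X Z K Y₁ Y₀) : Measurable Y₁ :=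
  h.1.1.fst

lemma IsMIVSelection.measurable_snd (h : IsMIVSelection μ X Z K Y₁ Y₀) : Measurable Y₀ :=
  h.1.1.snd

lemma IsMIVSelection.integrable_fst (h : IsMIVSelection μ X Z K Y₁ Y₀) : Integrable Y₁ μ :=
  h.1.2.1.fst

lemma IsMIVSelection.integrable_snd (h : IsMIVSelection μ X Z K Y₁ Y₀) : Integrable Y₀ μ :=
  h.1.2.1.snd

/-- The increase of the welfare gain when the means of the potential outcomes are moved to their
bounds, or by at most `N`, in the favourable direction. -/
noncomputable def gainSlack (μ : Measure Ω) (X : Ω → 𝒳) (Z : Ω → 𝒵) (K : Ω → Set (ℝ × ℝ))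
    (δ δ' : 𝒳 → Fin 2) (Y₁ Y₀ : Ω → ℝ) (N : ℝ≥0∞) : ℝ≥0∞ :=
  slack (· ≤ ·) μ X Z (fun ω => supportFun (1, 0) (K ω)) Y₁ (switchSet X δ δ') N +
      slack (fun a b => b ≤ a) μ X Z (fun ω => supportFun (-(0, 1)) (K ω)) (fun ω => -Y₀ ω)
        (switchSet X δ δ') N +
    (slack (fun a b => b ≤ a) μ X Z (fun ω => supportFun (-(1, 0)) (K ω)) (fun ω => -Y₁ ω)
        (switchSet X δ' δ) N +
      slack (· ≤ ·) μ X Z (fun ω => supportFun (0, 1) (K ω)) Y₀ (switchSet X δ' δ) N)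

lemma IsMIVSelection.minorant_fst (h : IsMIVSelection μ X Z K Y₁ Y₀) (hK : IsRandomClosedSet K) :
    IsMonotoneMinorant (· ≤ ·) μ X Z (fun ω => supportFun (1, 0) (K ω)) Y₁ where
  measurable_majorant := measurable_supportFun hK _
  measurable := h.measurable_fst
  integrable := h.integrable_fst
  le := by
    filter_upwards [h.1.2.2] with ω hω
    simpa using coe_le_supportFun hω (1, 0)
  mono := meanMonotone_iff.1 h.2.1

lemma IsMIVSelection.minorant_snd (h : IsMIVSelection μ X Z K Y₁ Y₀) (hK : IsRandomClosedSet K) :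
    IsMonotoneMinorant (· ≤ ·) μ X Z (fun ω => supportFun (0, 1) (K ω)) Y₀ where
  measurable_majorant := measurable_supportFun hK _
  measurable := h.measurable_snd
  integrable := h.integrable_snd
  le := by
    filter_upwards [h.1.2.2] with ω hω
    simpa using coe_le_supportFun hω (0, 1)
  mono := meanMonotone_iff.1 h.2.2

variable [IsProbabilityMeasure μ]

lemma welfareGain_convex_comb (hX : Measurable X) (hδ : Measurable δ) (hδ' : Measurable δ')
    (h : IsMIVSelection μ X Z K Y₁ Y₀) (h' : IsMIVSelection μ X Z K W₁ W₀) (a b : ℝ) :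
    welfareGain μ X δ δ' (fun ω => a * Y₁ ω + b * W₁ ω) (fun ω => a * Y₀ ω + b * W₀ ω) =
      a * welfareGain μ X δ δ' Y₁ Y₀ + b * welfareGain μ X δ δ' W₁ W₀ := by
  have h₁ : Integrable (fun ω => a * Y₁ ω + b * W₁ ω) μ :=
    (h.integrable_fst.const_mul a).add (h'.integrable_fst.const_mul b)
  have h₀ : Integrable (fun ω => a * Y₀ ω + b * W₀ ω) μ :=
    (h.integrable_snd.const_mul a).add (h'.integrable_snd.const_mul b)
  rw [welfareGain_eq hX hδ hδ' h.integrable_fst h.integrable_snd,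
    welfareGain_eq hX hδ hδ' h'.integrable_fst h'.integrable_snd, welfareGain_eq hX hδ hδ' h₁ h₀]
  have key : ∀ s : Set Ω, ∫ ω in s, (a * Y₁ ω + b * W₁ ω - (a * Y₀ ω + b * W₀ ω)) ∂μ =
      a * ∫ ω in s, (Y₁ ω - Y₀ ω) ∂μ + b * ∫ ω in s, (W₁ ω - W₀ ω) ∂μ := by
    intro s
    have ha : Integrable (fun ω => a * (Y₁ ω - Y₀ ω)) (μ.restrict s) :=
      ((h.integrable_fst.sub h.integrable_snd).const_mul a).restrict
    have hb : Integrable (fun ω => b * (W₁ ω - W₀ ω)) (μ.restrict s) :=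
      ((h'.integrable_fst.sub h'.integrable_snd).const_mul b).restrict
    rw [← integral_const_mul, ← integral_const_mul, ← integral_add ha hb]
    refine integral_congr_ae (Eventually.of_forall fun ω => ?_)
    simp only
    ring
  rw [key, key]
  ring

variable [MeasurableSpace 𝒵] [MeasurableSingletonClass 𝒵]

lemma IsMIVSelection.minorant_neg_fst (h : IsMIVSelection μ X Z K Y₁ Y₀)
    (hK : IsRandomClosedSet K) (hX : Measurable X) (hZ : Measurable Z) :
    IsMonotoneMinorant (fun a b => b ≤ a) μ X Z (fun ω => supportFun (-(1, 0)) (K ω))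
      (fun ω => -Y₁ ω) where
  measurable_majorant := measurable_supportFun hK _
  measurable := h.measurable_fst.neg
  integrable := h.integrable_fst.neg
  le := by
    filter_upwards [h.1.2.2] with ω hω
    simpa using coe_le_supportFun hω (-(1, 0))
  mono := (meanMonotone_iff.1 h.2.1).neg hX hZ

lemma IsMIVSelection.minorant_neg_snd (h : IsMIVSelection μ X Z K Y₁ Y₀)
    (hK : IsRandomClosedSet K) (hX : Measurable X) (hZ : Measurable Z) :
    IsMonotoneMinorant (fun a b => b ≤ a) μ X Z (fun ω => supportFun (-(0, 1)) (K ω))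
      (fun ω => -Y₀ ω) where
  measurable_majorant := measurable_supportFun hK _
  measurable := h.measurable_snd.neg
  integrable := h.integrable_snd.neg
  le := by
    filter_upwards [h.1.2.2] with ω hω
    simpa using coe_le_supportFun hω (-(0, 1))
  mono := (meanMonotone_iff.1 h.2.2).neg hX hZ

lemma IsMIVSelection.convex_comb (hX : Measurable X) (hZ : Measurable Z)
    (hconv : ∀ᵐ ω ∂μ, Convex ℝ (K ω)) (h : IsMIVSelection μ X Z K Y₁ Y₀)
    (h' : IsMIVSelection μ X Z K W₁ W₀) {a b : ℝ} (ha : 0 ≤ a) (hb : 0 ≤ b) (hab : a + b = 1) :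
    IsMIVSelection μ X Z K (fun ω => a * Y₁ ω + b * W₁ ω) (fun ω => a * Y₀ ω + b * W₀ ω) := by
  refine ⟨⟨?_, ?_, ?_⟩, ?_, ?_⟩
  · exact ((h.measurable_fst.const_mul a).add (h'.measurable_fst.const_mul b)).prodMk
      ((h.measurable_snd.const_mul a).add (h'.measurable_snd.const_mul b))
  · exact ((h.integrable_fst.const_mul a).add (h'.integrable_fst.const_mul b)).prodMk
      ((h.integrable_snd.const_mul a).add (h'.integrable_snd.const_mul b))
  · filter_upwards [hconv, h.1.2.2, h'.1.2.2] with ω hc h1 h2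
    simpa using hc h1 h2 ha hb hab
  · exact meanMonotone_iff.2 ((meanMonotone_iff.1 h.2.1).convex_comb hX hZ h.integrable_fst
      h'.integrable_fst (meanMonotone_iff.1 h'.2.1) ha hb)
  · exact meanMonotone_iff.2 ((meanMonotone_iff.1 h.2.2).convex_comb hX hZ h.integrable_snd
      h'.integrable_snd (meanMonotone_iff.1 h'.2.2) ha hb)

variable [Countable 𝒵]

/-- The bounds exceed the welfare gain of any selection exactly by its slack. -/
lemma gainBound_eq_welfareGain_add (hX : Measurable X) (hZ : Measurable Z)
    (hK : IsRandomClosedSet K) (h : IsMIVSelection μ X Z K Y₁ Y₀) (hδ : Measurable δ)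
    (hδ' : Measurable δ') :
    gainBound μ X δ δ' (cateUpper μ X Z K (probGiven μ X Z))
        (cateLower μ X Z K (probGiven μ X Z)) =
      (welfareGain μ X δ δ' Y₁ Y₀ : EReal) + (gainSlack μ X Z K δ δ' Y₁ Y₀ ⊤ : EReal) ∧
    gainBound μ X δ' δ (cateLower μ X Z K (probGiven μ X Z))
        (cateUpper μ X Z K (probGiven μ X Z)) =
      -((welfareGain μ X δ δ' Y₁ Y₀ : EReal) + (gainSlack μ X Z K δ δ' Y₁ Y₀ ⊤ : EReal)) := by
  have hm : sigma X ≤ _ := hX.comap_le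
  have hA : MeasurableSet[sigma X] (switchSet X δ δ') := measurableSet_switchSet hδ hδ'
  have hB : MeasurableSet[sigma X] (switchSet X δ' δ) := measurableSet_switchSet hδ' hδ
  have hu := eSum_probGiven_mul_upperEnv_add hX hZ (h.minorant_fst hK)
    (h.minorant_neg_snd hK hX hZ)
  have hl := eSum_probGiven_mul_upperEnv_add hX hZ (h.minorant_neg_fst hK hX hZ)
    (h.minorant_snd hK)
  set M₁ := μ[fun ω => Y₁ ω + -Y₀ ω | sigma X] with hM₁
  set M₂ := μ[fun ω => -Y₁ ω + Y₀ ω | sigma X] with hM₂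
  set G₁ : Ω → ℝ≥0∞ := fun ω => ∑' z, ENNReal.ofReal (probGiven μ X Z z ω) *
    (gap (· ≤ ·) μ X Z (fun ω => supportFun (1, 0) (K ω)) Y₁ z ω +
      gap (fun a b => b ≤ a) μ X Z (fun ω => supportFun (-(0, 1)) (K ω)) (fun ω => -Y₀ ω) z ω)
  set G₂ : Ω → ℝ≥0∞ := fun ω => ∑' z, ENNReal.ofReal (probGiven μ X Z z ω) *
    (gap (fun a b => b ≤ a) μ X Z (fun ω => supportFun (-(1, 0)) (K ω)) (fun ω => -Y₁ ω) z ω +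
      gap (· ≤ ·) μ X Z (fun ω => supportFun (0, 1) (K ω)) Y₀ z ω)
  have hup : ∀ᵐ ω ∂μ, cateUpper μ X Z K (probGiven μ X Z) ω =
      (M₁ ω : EReal) + (G₁ ω : EReal) := by
    filter_upwards [hu] with ω hω
    rw [← hω.1]
    unfold cateUpper
    congr 1
    ext z
    rw [supLower_eq_neg_upperEnv, sub_eq_add_neg, neg_neg]
    rfl
  have hlo : ∀ᵐ ω ∂μ, cateLower μ X Z K (probGiven μ X Z) ω =
      -((M₂ ω : EReal) + (G₂ ω : EReal)) := by
    filter_upwards [hl] with ω hω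
    rw [← hω.2]
    unfold cateLower
    congr 1
    ext z
    rw [supLower_eq_neg_upperEnv]
    rfl
  have hgm : ∀ {r : 𝒵 → 𝒵 → Prop} {S : Ω → EReal} {Y : Ω → ℝ} (z : 𝒵),
      Measurable (gap r μ X Z S Y z) := fun z => (measurable_gap z).mono hm le_rfl
  have hpm : ∀ z, Measurable fun ω => ENNReal.ofReal (probGiven μ X Z z ω) :=
    fun z => ((measurable_probGiven z).mono hm le_rfl).ennreal_ofReal
  have hG₁m : Measurable G₁ := Measurable.tsum fun z => (hpm z).mul ((hgm z).add (hgm z))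
  have hG₂m : Measurable G₂ := Measurable.tsum fun z => (hpm z).mul ((hgm z).add (hgm z))
  -- The integrand is the upper bound on one switching event and minus the lower bound on the other;
  -- as these are disjoint, it equals `c + d`. The integrand of the second claim is `-(c + d)`.
  let c : Ω → ℝ := fun ω =>
    (switchSet X δ δ').indicator M₁ ω + (switchSet X δ' δ).indicator M₂ ω
  let d : Ω → ℝ≥0∞ := fun ω =>
    (switchSet X δ δ').indicator G₁ ω + (switchSet X δ' δ).indicator G₂ ω
  have hc : Integrable c μ := (integrable_condExp.indicator (hm _ hA)).add
    (integrable_condExp.indicator (hm _ hB))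
  have hd : Measurable d := (hG₁m.indicator (hm _ hA)).add (hG₂m.indicator (hm _ hB))
  have hcint : ∫ ω, c ω ∂μ = welfareGain μ X δ δ' Y₁ Y₀ := by
    have e1 : ∫ ω in switchSet X δ δ', M₁ ω ∂μ = ∫ ω in switchSet X δ δ', (Y₁ ω - Y₀ ω) ∂μ := by
      have hi : Integrable (fun ω => Y₁ ω + -Y₀ ω) μ := h.integrable_fst.add h.integrable_snd.neg
      rw [hM₁, setIntegral_condExp hm hi hA]
      rfl
    have e2 : ∫ ω in switchSet X δ' δ, M₂ ω ∂μ =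
        -∫ ω in switchSet X δ' δ, (Y₁ ω - Y₀ ω) ∂μ := by
      have hi : Integrable (fun ω => -Y₁ ω + Y₀ ω) μ := h.integrable_fst.neg.add h.integrable_snd
      rw [hM₂, setIntegral_condExp hm hi hB, ← integral_neg]
      refine integral_congr_ae (Eventually.of_forall fun ω => ?_)
      simp only
      ring
    rw [welfareGain_eq hX hδ hδ' h.integrable_fst h.integrable_snd,
      integral_add (integrable_condExp.indicator (hm _ hA))
        (integrable_condExp.indicator (hm _ hB)), integral_indicator (hm _ hA),
      integral_indicator (hm _ hB), e1, e2, sub_eq_add_neg]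
  have hdint : ∫⁻ ω, d ω ∂μ = gainSlack μ X Z K δ δ' Y₁ Y₀ ⊤ := by
    rw [lintegral_add_left (hG₁m.indicator (hm _ hA)), lintegral_indicator (hm _ hA),
      lintegral_indicator (hm _ hB), setLIntegral_tsum_gap_add hX, setLIntegral_tsum_gap_add hX]
    rfl
  rw [← hcint, ← hdint]
  constructor
  · refine eExp_add_coe hc hd.aemeasurable ?_
    filter_upwards [hup, hlo] with ω h1 h2
    rw [h1, h2]
    by_cases ha : ω ∈ switchSet X δ δ'
    · have hb := Set.disjoint_left.1 disjoint_switchSet ha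
      simp [switch_of_mem ha, switch_of_notMem hb, c, d, ha, hb]
    · by_cases hb : ω ∈ switchSet X δ' δ
      · simp [switch_of_notMem ha, switch_of_mem hb, c, d, ha, hb]
      · simp [switch_of_notMem ha, switch_of_notMem hb, c, d, ha, hb]
  · refine eExp_neg_add_coe hc hd.aemeasurable ?_
    filter_upwards [hup, hlo] with ω h1 h2
    rw [h1, h2]
    by_cases ha : ω ∈ switchSet X δ δ'
    · have hb := Set.disjoint_left.1 disjoint_switchSet ha
      simp [switch_of_mem ha, switch_of_notMem hb, c, d, ha, hb]
    · by_cases hb : ω ∈ switchSet X δ' δ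
      · simp [switch_of_notMem ha, switch_of_mem hb, c, d, ha, hb]
      · simp [switch_of_notMem ha, switch_of_notMem hb, c, d, ha, hb]

end Selection

end Gain

section Attainment

variable {Ω 𝒳 𝒵 : Type*} [MeasurableSpace Ω] [MeasurableSpace 𝒳] {μ : Measure Ω} {X : Ω → 𝒳}
  {Z : Ω → 𝒵} {δ δ' : 𝒳 → Fin 2} [PartialOrder 𝒵] [Countable 𝒵]

/-! ### Attainment of the bounds -/

section Truncation

variable [IsProbabilityMeasure μ] [MeasurableSpace 𝒵] [MeasurableSingletonClass 𝒵]
  {K : Ω → Set (ℝ × ℝ)} {Y₁ Y₀ : Ω → ℝ}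

/-- Either the whole slack is finite, or its truncations are finite and unbounded. -/
lemma exists_gainSlack_ge (hX : Measurable X) (hZ : Measurable Z) {t : ℝ≥0∞} (ht : t ≠ ⊤)
    (h : t ≤ gainSlack μ X Z K δ δ' Y₁ Y₀ ⊤) :
    ∃ N, gainSlack μ X Z K δ δ' Y₁ Y₀ N ≠ ⊤ ∧ t ≤ gainSlack μ X Z K δ δ' Y₁ Y₀ N := by
  by_cases htop : gainSlack μ X Z K δ δ' Y₁ Y₀ ⊤ = ⊤
  swap
  · exact ⟨⊤, htop, h⟩
  have hfin : ∀ n : ℕ, gainSlack μ X Z K δ δ' Y₁ Y₀ n ≠ ⊤ := by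
    intro n
    simp only [gainSlack, ne_eq, ENNReal.add_eq_top, not_or]
    exact ⟨⟨slack_natCast_ne_top hX hZ _ n, slack_natCast_ne_top hX hZ _ n⟩,
      slack_natCast_ne_top hX hZ _ n, slack_natCast_ne_top hX hZ _ n⟩
  suffices hex : ∃ n : ℕ, t ≤ gainSlack μ X Z K δ δ' Y₁ Y₀ n by
    obtain ⟨n, hn⟩ := hex
    exact ⟨n, hfin n, hn⟩
  -- An infinite `gainSlack` has an infinite summand, whose truncations alone exceed `t`.
  have key : ∀ {r : 𝒵 → 𝒵 → Prop} {S : Ω → EReal} {Y : Ω → ℝ} {A : Set Ω},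
      slack r μ X Z S Y A ⊤ = ⊤ → ∃ n : ℕ, t ≤ slack r μ X Z S Y A n := by
    intro r S Y A hs
    rw [← iSup_slack_natCast hX] at hs
    obtain ⟨n, hn⟩ := lt_iSup_iff.1 (hs.symm ▸ ht.lt_top)
    exact ⟨n, hn.le⟩
  simp only [gainSlack, ENNReal.add_eq_top] at htop
  unfold gainSlack
  rcases htop with (h | h) | (h | h)
  · exact (key h).imp fun n hn => hn.trans (le_self_add.trans le_self_add)
  · exact (key h).imp fun n hn => hn.trans (le_add_self.trans le_self_add)
  · exact (key h).imp fun n hn => hn.trans (le_self_add.trans le_add_self)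
  · exact (key h).imp fun n hn => hn.trans (le_add_self.trans le_add_self)

end Truncation

variable [IsProbabilityMeasure μ] [MeasurableSpace 𝒵] [MeasurableSingletonClass 𝒵]
  {𝒴₁ 𝒴₀ : Ω → Set ℝ} {Y₁ Y₀ : Ω → ℝ}

/-- Where only `δ` treats, `Y₁` is raised and `Y₀` lowered; where only `δ'` treats, the reverse. -/
lemma exists_welfareGain_eq_add_gainSlack (hX : Measurable X) (hZ : Measurable Z)
    (hK : IsRandomClosedSet fun ω => 𝒴₁ ω ×ˢ 𝒴₀ ω)
    (hconv : ∀ᵐ ω ∂μ, Convex ℝ (𝒴₁ ω ×ˢ 𝒴₀ ω))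
    (h : IsMIVSelection μ X Z (fun ω => 𝒴₁ ω ×ˢ 𝒴₀ ω) Y₁ Y₀) (hδ : Measurable δ)
    (hδ' : Measurable δ') {N : ℝ≥0∞}
    (hfin : gainSlack μ X Z (fun ω => 𝒴₁ ω ×ˢ 𝒴₀ ω) δ δ' Y₁ Y₀ N ≠ ⊤) :
    ∃ W₁ W₀, IsMIVSelection μ X Z (fun ω => 𝒴₁ ω ×ˢ 𝒴₀ ω) W₁ W₀ ∧
      welfareGain μ X δ δ' W₁ W₀ = welfareGain μ X δ δ' Y₁ Y₀ +
        (gainSlack μ X Z (fun ω => 𝒴₁ ω ×ˢ 𝒴₀ ω) δ δ' Y₁ Y₀ N).toReal := by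
  have hm : sigma X ≤ _ := hX.comap_le
  have hA : MeasurableSet[sigma X] (switchSet X δ δ') := measurableSet_switchSet hδ hδ'
  have hB : MeasurableSet[sigma X] (switchSet X δ' δ) := measurableSet_switchSet hδ' hδ
  have hBA : switchSet X δ' δ ⊆ (switchSet X δ δ')ᶜ := fun ω hb ha =>
    Set.disjoint_left.1 disjoint_switchSet ha hb
  simp only [gainSlack, ne_eq, ENNReal.add_eq_top, not_or] at hfin
  obtain ⟨⟨f1u, f0d⟩, f1d, f0u⟩ := hfin
  obtain ⟨U₁, mU₁, iU₁, leU₁, ubU₁, moU₁, eU₁⟩ := (h.minorant_fst hK).exists_raise hX hZ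
    (fun a => le_refl a) (fun a b c => le_trans) hA f1u
  obtain ⟨U₀, mU₀, iU₀, leU₀, ubU₀, moU₀, eU₀⟩ := (h.minorant_snd hK).exists_raise hX hZ
    (fun a => le_refl a) (fun a b c => le_trans) hB f0u
  obtain ⟨L₁, mL₁, iL₁, leL₁, ubL₁, moL₁, eL₁⟩ := (h.minorant_neg_fst hK hX hZ).exists_raise hX hZ
    (fun a => le_refl a) (fun a b c hab hbc => le_trans hbc hab) hB f1d
  obtain ⟨L₀, mL₀, iL₀, leL₀, ubL₀, moL₀, eL₀⟩ := (h.minorant_neg_snd hK hX hZ).exists_raise hX hZ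
    (fun a => le_refl a) (fun a b c hab hbc => le_trans hbc hab) hA f0d
  set A := switchSet X δ δ' with hAdef
  set B := switchSet X δ' δ with hBdef
  -- Where the rules agree the gain is unaffected, so the second modification can be used on all of
  -- `Aᶜ`.
  let W₁ : Ω → ℝ := fun ω => A.indicator U₁ ω + Aᶜ.indicator (fun ω => -L₁ ω) ω
  let W₀ : Ω → ℝ := fun ω => A.indicator (fun ω => -L₀ ω) ω + Aᶜ.indicator U₀ ω
  have mW₁ : Measurable W₁ := (mU₁.indicator (hm _ hA)).add (mL₁.neg.indicator (hm _ hA.compl))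
  have mW₀ : Measurable W₀ := (mL₀.neg.indicator (hm _ hA)).add (mU₀.indicator (hm _ hA.compl))
  have iW₁ : Integrable W₁ μ := (iU₁.indicator (hm _ hA)).add (iL₁.neg.indicator (hm _ hA.compl))
  have iW₀ : Integrable W₀ μ := (iL₀.neg.indicator (hm _ hA)).add (iU₀.indicator (hm _ hA.compl))
  refine ⟨W₁, W₀, ⟨⟨mW₁.prodMk mW₀, iW₁.prodMk iW₀, ?_⟩, ?_, ?_⟩, ?_⟩
  · filter_upwards [h.1.2.2, hconv, ubU₁, ubU₀, ubL₁, ubL₀] with ω hsel hc h1 h2 h3 h4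
    have c₁ := convex_fst_of_prod hc ⟨_, hsel.2⟩
    have c₀ := convex_snd_of_prod hc ⟨_, hsel.1⟩
    have k₁ := isClosed_fst_of_prod (hK.1 ω) ⟨_, hsel.2⟩
    have k₀ := isClosed_snd_of_prod (hK.1 ω) ⟨_, hsel.1⟩
    by_cases hω : ω ∈ A
    · have e₁ : W₁ ω = U₁ ω := by simp [W₁, hω]
      have e₀ : W₀ ω = -L₀ ω := by simp [W₀, hω]
      rw [e₁, e₀]
      exact ⟨fst_mem_of_le_supportFun c₁ k₁ hsel.1 (leU₁ ω) h1,
        neg_snd_mem_of_le_supportFun c₀ k₀ hsel.2 (leL₀ ω) h4⟩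
    · have e₁ : W₁ ω = -L₁ ω := by simp [W₁, hω]
      have e₀ : W₀ ω = U₀ ω := by simp [W₀, hω]
      rw [e₁, e₀]
      exact ⟨neg_fst_mem_of_le_supportFun c₁ k₁ hsel.1 (leL₁ ω) h3,
        snd_mem_of_le_supportFun c₀ k₀ hsel.2 (leU₀ ω) h2⟩
  · exact meanMonotone_iff.2 (moU₁.indicator_add hX hZ iU₁ iL₁.neg (moL₁.neg hX hZ) hA)
  · exact meanMonotone_iff.2 ((moL₀.neg hX hZ).indicator_add hX hZ iL₀.neg iU₀ moU₀ hA)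
  · have eA : ∫ ω in A, (W₁ ω - W₀ ω) ∂μ = ∫ ω in A, U₁ ω ∂μ + ∫ ω in A, L₀ ω ∂μ := by
      rw [← integral_add iU₁.integrableOn iL₀.integrableOn]
      refine setIntegral_congr_fun (hm _ hA) fun ω hω => ?_
      simp [W₁, W₀, hω]
    have eB : ∫ ω in B, (W₁ ω - W₀ ω) ∂μ = -(∫ ω in B, L₁ ω ∂μ + ∫ ω in B, U₀ ω ∂μ) := by
      rw [← integral_add iL₁.integrableOn iU₀.integrableOn, ← integral_neg]
      refine setIntegral_congr_fun (hm _ hB) fun ω hω => ?_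
      have hωA : ω ∉ A := hBA hω
      simp [W₁, W₀, hωA]
      ring
    rw [welfareGain_eq hX hδ hδ' iW₁ iW₀,
      welfareGain_eq hX hδ hδ' h.integrable_fst h.integrable_snd, ← hAdef, ← hBdef, eA, eB, eU₁, eL₀,
      eL₁, eU₀, integral_neg, integral_neg,
      integral_sub h.integrable_fst.integrableOn h.integrable_snd.integrableOn,
      integral_sub h.integrable_fst.integrableOn h.integrable_snd.integrableOn]
    unfold gainSlack
    rw [ENNReal.toReal_add (ENNReal.add_ne_top.2 ⟨f1u, f0d⟩) (ENNReal.add_ne_top.2 ⟨f1d, f0u⟩),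
      ENNReal.toReal_add f1u f0d, ENNReal.toReal_add f1d f0u]
    ring

lemma exists_le_welfareGain (hX : Measurable X) (hZ : Measurable Z)
    (hK : IsRandomClosedSet fun ω => 𝒴₁ ω ×ˢ 𝒴₀ ω)
    (hconv : ∀ᵐ ω ∂μ, Convex ℝ (𝒴₁ ω ×ˢ 𝒴₀ ω))
    (h : IsMIVSelection μ X Z (fun ω => 𝒴₁ ω ×ˢ 𝒴₀ ω) Y₁ Y₀) (hδ : Measurable δ)
    (hδ' : Measurable δ') {β : ℝ}
    (hβ : (β : EReal) ≤ gainBound μ X δ δ'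
      (cateUpper μ X Z (fun ω => 𝒴₁ ω ×ˢ 𝒴₀ ω) (probGiven μ X Z))
      (cateLower μ X Z (fun ω => 𝒴₁ ω ×ˢ 𝒴₀ ω) (probGiven μ X Z))) :
    ∃ W₁ W₀, IsMIVSelection μ X Z (fun ω => 𝒴₁ ω ×ˢ 𝒴₀ ω) W₁ W₀ ∧
      β ≤ welfareGain μ X δ δ' W₁ W₀ := by
  rw [(gainBound_eq_welfareGain_add hX hZ hK h hδ hδ').1] at hβ
  -- The increase still needed to reach `β`, zero if the given selection already does.
  have ht : ENNReal.ofReal (β - welfareGain μ X δ δ' Y₁ Y₀) ≤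
      gainSlack μ X Z (fun ω => 𝒴₁ ω ×ˢ 𝒴₀ ω) δ δ' Y₁ Y₀ ⊤ := by
    rw [← toENNReal_coe_add_sub (welfareGain μ X δ δ' Y₁ Y₀) (gainSlack _ _ _ _ _ _ _ _ _),
      ← EReal.real_coe_toENNReal, EReal.coe_sub]
    exact EReal.toENNReal_le_toENNReal (EReal.sub_le_sub hβ le_rfl)
  obtain ⟨N, hN, hle⟩ := exists_gainSlack_ge hX hZ ENNReal.ofReal_ne_top ht
  obtain ⟨W₁, W₀, hW, hg⟩ := exists_welfareGain_eq_add_gainSlack hX hZ hK hconv h hδ hδ' hN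
  refine ⟨W₁, W₀, hW, ?_⟩
  have := (ENNReal.ofReal_le_iff_le_toReal hN).1 hle
  linarith

lemma identifiedSet_eq_mivInterval (hX : Measurable X) (hZ : Measurable Z)
    (hK : IsRandomClosedSet fun ω => 𝒴₁ ω ×ˢ 𝒴₀ ω)
    (hconv : ∀ᵐ ω ∂μ, Convex ℝ (𝒴₁ ω ×ˢ 𝒴₀ ω))
    (h : IsMIVSelection μ X Z (fun ω => 𝒴₁ ω ×ˢ 𝒴₀ ω) Y₁ Y₀) (hδ : Measurable δ)
    (hδ' : Measurable δ') :
    identifiedSet μ X Z (fun ω => 𝒴₁ ω ×ˢ 𝒴₀ ω) δ δ' =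
      mivInterval μ X Z (fun ω => 𝒴₁ ω ×ˢ 𝒴₀ ω) (probGiven μ X Z) δ δ' := by
  have hswap : ∀ {W₁ W₀ : Ω → ℝ}, IsMIVSelection μ X Z (fun ω => 𝒴₁ ω ×ˢ 𝒴₀ ω) W₁ W₀ →
      welfareGain μ X δ' δ W₁ W₀ = -welfareGain μ X δ δ' W₁ W₀ := by
    intro W₁ W₀ hW
    rw [welfareGain_eq hX hδ hδ' hW.integrable_fst hW.integrable_snd,
      welfareGain_eq hX hδ' hδ hW.integrable_fst hW.integrable_snd, neg_sub]
  have hle : ∀ (g : ℝ) (d : ℝ≥0∞), (g : EReal) ≤ (g : EReal) + (d : EReal) := fun g d =>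
    le_add_of_nonneg_right (EReal.coe_ennreal_nonneg d)
  ext β
  constructor
  · rintro ⟨W₁, W₀, hW, rfl⟩
    constructor
    · rw [(gainBound_eq_welfareGain_add hX hZ hK hW hδ' hδ).2, EReal.neg_le, ← EReal.coe_neg,
        ← hswap hW]
      exact hle _ _
    · rw [(gainBound_eq_welfareGain_add hX hZ hK hW hδ hδ').1]
      exact hle _ _
  · rintro ⟨hl, hu⟩
    obtain ⟨W₁, W₀, hW, hWβ⟩ := exists_le_welfareGain hX hZ hK hconv h hδ hδ' hu
    -- The lower bound is minus the upper bound for the exchanged rules, so `-β` can be attained or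
    -- exceeded after the exchange.
    rw [(gainBound_eq_welfareGain_add hX hZ hK h hδ' hδ).2,
      ← (gainBound_eq_welfareGain_add hX hZ hK h hδ' hδ).1, EReal.neg_le, ← EReal.coe_neg] at hl
    obtain ⟨V₁, V₀, hV, hVβ⟩ := exists_le_welfareGain hX hZ hK hconv h hδ' hδ hl
    rw [hswap hV, neg_le_neg_iff] at hVβ
    have hseg : β ∈ segment ℝ (welfareGain μ X δ δ' V₁ V₀) (welfareGain μ X δ δ' W₁ W₀) := by
      rw [segment_eq_Icc (hVβ.trans hWβ)]
      exact ⟨hVβ, hWβ⟩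
    obtain ⟨a, b, ha, hb, hab, he⟩ := hseg
    refine ⟨_, _, hV.convex_comb hX hZ hconv hW ha hb hab, ?_⟩
    rw [welfareGain_convex_comb hX hδ hδ' hV hW, ← he]
    simp

end Attainment

end WelfareGain

theorem theorem3 {Ω 𝒳 𝒵 : Type*} [MeasurableSpace Ω] (μ : Measure Ω) [IsProbabilityMeasure μ]
    [MeasurableSpace 𝒳]
    [PartialOrder 𝒵] [Countable 𝒵] [MeasurableSpace 𝒵] [MeasurableSingletonClass 𝒵]
    (X : Ω → 𝒳) (hX : Measurable X) (Z : Ω → 𝒵) (hZ : Measurable Z)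
    (𝒴₁ 𝒴₀ : Ω → Set ℝ)
    (hint : WelfareGain.IsIntegrableRandomSet μ (fun ω => 𝒴₁ ω ×ˢ 𝒴₀ ω))
    (hconv : ∀ᵐ ω ∂μ, Convex ℝ (𝒴₁ ω ×ˢ 𝒴₀ ω))
    (Y₁ Y₀ : Ω → ℝ)
    (hY : WelfareGain.IsMIVSelection μ X Z (fun ω => 𝒴₁ ω ×ˢ 𝒴₀ ω) Y₁ Y₀)
    (δ δ' : 𝒳 → Fin 2) (hδ : Measurable δ) (hδ' : Measurable δ') :
    WelfareGain.identifiedSet μ X Z (fun ω => 𝒴₁ ω ×ˢ 𝒴₀ ω) δ δ' =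
        WelfareGain.mivInterval μ X Z (fun ω => 𝒴₁ ω ×ˢ 𝒴₀ ω)
          (WelfareGain.probGiven μ X Z) δ δ' ∧
      (IndepFun X Z μ →
        WelfareGain.identifiedSet μ X Z (fun ω => 𝒴₁ ω ×ˢ 𝒴₀ ω) δ δ' =
          WelfareGain.mivInterval μ X Z (fun ω => 𝒴₁ ω ×ˢ 𝒴₀ ω)
            (fun z _ => μ.real (Z ⁻¹' {z})) δ δ') := by
  have main := WelfareGain.identifiedSet_eq_mivInterval hX hZ hint.1 hconv hY hδ hδ'
  refine ⟨main, fun hind => main.trans ?_⟩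
  -- Under independence the two systems of weights agree almost surely, and the bounds depend on
  -- them only up to null sets.
  have hp := WelfareGain.probGiven_ae_eq_of_indepFun hX hZ hind
  have hu : WelfareGain.cateUpper μ X Z (fun ω => 𝒴₁ ω ×ˢ 𝒴₀ ω) (WelfareGain.probGiven μ X Z)
      =ᵐ[μ] WelfareGain.cateUpper μ X Z (fun ω => 𝒴₁ ω ×ˢ 𝒴₀ ω)
        (fun z _ => μ.real (Z ⁻¹' {z})) := by
    filter_upwards [hp] with ω hω
    simp only [WelfareGain.cateUpper, hω]
  have hl : WelfareGain.cateLower μ X Z (fun ω => 𝒴₁ ω ×ˢ 𝒴₀ ω) (WelfareGain.probGiven μ X Z)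
      =ᵐ[μ] WelfareGain.cateLower μ X Z (fun ω => 𝒴₁ ω ×ˢ 𝒴₀ ω)
        (fun z _ => μ.real (Z ⁻¹' {z})) := by
    filter_upwards [hp] with ω hω
    simp only [WelfareGain.cateLower, hω]
  unfold WelfareGain.mivInterval
  rw [WelfareGain.gainBound_congr hu hl, WelfareGain.gainBound_congr hl hu]
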